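/- Let $(\Omega,\mathcal F,\mathbb P)$ be a probability space and consider the system $$y_{k+1}=\theta^{*T}x_k+w_{k+1},\qquad k\ge 0,$$ with $x_k\in\mathbb R^d$, $y_{k+1},w_{k+1}\in\mathbb R$ and a fixed vector $\theta^*\in\mathbb R^d$. Let $l>0$ (for the loss $\Phi(t)=|t|$ one may take $l=1$), and assume: (A2) The random vectors $x_k$, $k\ge 0$, have a common probability density $q$, and there is $r>0$ such that $q>0$ on the ball $B_r(0)\subset\mathbb R^d$. Moreover $\mathbb E x_k=0$, $\mathbb E\|x_k\|^{2(l+2)+\epsilon_0}<\infty$ for some $\epsilon_0>0$, and $\{x_k\}_{k\ge0}$ is $\phi$-mixing with $\phi_k\le\mu\rho^k$, $k\ge0$, for some $\mu>0$ and $0<\rho<1$, where $$\phi_k=\sup_{n\ge0}\ \sup_{A\in\sigma(x_0,\dots,x_n),\ \mathbb P(A)>0,\ B\in\sigma(x_{n+k},x_{n+k+1},\dots)}\frac{|\mathbb P(A\cap B)-\mathbb P(A)\mathbb P(B)|}{\mathbb P(A)} .$$ (A3) The random variables $w_{k+1}$, $k\ge0$, are i.i.d. with a probability density $f_w$ that is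 even, continuous at $0$ and satisfies $f_w(0)>0$; $\mathbb E|w_{k+1}|^{2l+\epsilon_0}<\infty$ for some $\epsilon_0>0$; and for each $k\ge0$ the noise $w_{k+1}$ is independent of $(x_0,\dots,x_k,w_1,\dots,w_k)$. Let $\operatorname{sgn}(t)=1$ for $t\ge0$ and $\operatorname{sgn}(t)=-1$ for $t<0$. Let $\{M_k\}_{k\ge0}$ be any sequence of positive numbers diverging to infinity, let $\theta_1\in\mathbb R^d$ be arbitrary and let $s\ge 0$ be an integer. Define $\sigma_1=1$ and, for $k\ge1$, $$\bar\theta_{k+1}=\theta_k+\tfrac1k\,x_k\operatorname{sgn}(y_{k+1}-\theta_k^Tx_k),\qquad \theta_{k+1}=\bar\theta_{k+1}\,\mathbb I_{[\|\bar\theta_{k+1}\|\le M_{\sigma_k}]},\qquad \sigma_{k+1}=s+\sum_{i=1}^{k}\mathbb I_{[\|\bar\theta_{i+1}\|>M_{\sigma_i}]} .$$ Then $\theta_k\to\theta^*$ almost surely as $k\to\infty$. -/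

import Mathlib

open MeasureTheory ProbabilityTheory Filter Topology

/-- The sign function with the convention `sgn 0 = 1`. -/
noncomputable def sgn (t : ℝ) : ℝ := if 0 ≤ t then 1 else -1

section Mixing

/-- The `σ`-algebra generated by `z 0, …, z n`. -/
abbrev sigmaUpTo {Ω E : Type*} [MeasurableSpace E] (z : ℕ → Ω → E) (n : ℕ) : MeasurableSpace Ω :=
  ⨆ (i : ℕ) (_ : i ≤ n), MeasurableSpace.comap (z i) inferInstance

/-- The `σ`-algebra generated by `z n, z (n + 1), …`. -/
abbrev sigmaFrom {Ω E : Type*} [MeasurableSpace E] (z : ℕ → Ω → E) (n : ℕ) : MeasurableSpace Ω :=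
  ⨆ (i : ℕ) (_ : n ≤ i), MeasurableSpace.comap (z i) inferInstance

/-- The `k`-th `φ`-mixing coefficient of the process `z`: the supremum of
`|P(A ∩ B) - P(A) P(B)| / P(A)` over all `n`, all `A ∈ σ(z 0, …, z n)` with `P(A) > 0` and all
`B ∈ σ(z (n + k), z (n + k + 1), …)`. For a probability measure `P` and measurable `z` the set
below is non-empty and bounded by `1`. -/
noncomputable def phiMixingCoeff {Ω E : Type*} [MeasurableSpace Ω] [MeasurableSpace E]
    (P : Measure Ω) (z : ℕ → Ω → E) (k : ℕ) : ℝ :=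
  sSup {c : ℝ | ∃ (n : ℕ) (A B : Set Ω),
    MeasurableSet[sigmaUpTo z n] A ∧ 0 < P.real A ∧ MeasurableSet[sigmaFrom z (n + k)] B ∧
    c = |P.real (A ∩ B) - P.real A * P.real B| / P.real A}

end Mixing

section Assumptions

variable {Ω : Type*} [MeasurableSpace Ω] {d : ℕ}

/-- The assumption on the regressors `x 0, x 1, …`: a common probability density `q` that is
positive on a ball around the origin, mean zero, geometric `φ`-mixing, and a finite moment of order
`2 (l + 2) + ε₀`. -/
structure RegressorAssumption (P : Measure Ω) (x : ℕ → Ω → EuclideanSpace ℝ (Fin d))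
    (q : EuclideanSpace ℝ (Fin d) → ℝ) (l : ℝ) : Prop where
  measurable_x : ∀ k, Measurable (x k)
  measurable_q : Measurable q
  q_nonneg : ∀ u, 0 ≤ q u
  hasDensity : ∀ k, P.map (x k) = volume.withDensity (fun u => ENNReal.ofReal (q u))
  q_pos : ∃ r : ℝ, 0 < r ∧ ∀ u ∈ Metric.ball (0 : EuclideanSpace ℝ (Fin d)) r, 0 < q u
  mean_zero : ∀ k, ∫ ω, x k ω ∂P = 0
  mixing : ∃ μ ρ : ℝ, 0 < μ ∧ 0 < ρ ∧ ρ < 1 ∧ ∀ k, phiMixingCoeff P x k ≤ μ * ρ ^ k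
  moment : ∃ ε₀ : ℝ, 0 < ε₀ ∧ ∀ k, Integrable (fun ω => ‖x k ω‖ ^ (2 * (l + 2) + ε₀)) P

/-- The assumption on the noise `w 1, w 2, …` (the value `w 0` plays no role): i.i.d. with an even
density `f` that is positive and continuous at the origin, a finite moment of order `2 l + ε₀`, and
for each `k` the noise `w (k + 1)` is independent of the data `x 0, …, x k, w 1, …, w k` available
before it acts on the system. -/
structure NoiseAssumption (P : Measure Ω) (x : ℕ → Ω → EuclideanSpace ℝ (Fin d))
    (w : ℕ → Ω → ℝ) (f : ℝ → ℝ) (l : ℝ) : Prop where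
  measurable_w : ∀ k, Measurable (w (k + 1))
  iIndep : iIndepFun (fun k => w (k + 1)) P
  measurable_f : Measurable f
  f_nonneg : ∀ s, 0 ≤ f s
  hasDensity : ∀ k, P.map (w (k + 1)) = volume.withDensity (fun s => ENNReal.ofReal (f s))
  f_even : ∀ s, f (-s) = f s
  f_pos : 0 < f 0
  f_cont : ContinuousAt f 0
  indep_past : ∀ k, Indep (MeasurableSpace.comap (w (k + 1)) inferInstance)
    (sigmaUpTo x k ⊔
      ⨆ (i : ℕ) (_ : i < k), MeasurableSpace.comap (w (i + 1)) inferInstance) P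
  moment : ∃ ε₀ : ℝ, 0 < ε₀ ∧ ∀ k, Integrable (fun ω => |w (k + 1) ω| ^ (2 * l + ε₀)) P

end Assumptions

section Algorithm

variable {d : ℕ}

/-- The candidate `θ_k + (1/k) x_k sgn (y_{k+1} - θ_kᵀ x_k)` for the next estimate. -/
noncomputable def ladCandidate (x : ℕ → EuclideanSpace ℝ (Fin d)) (y : ℕ → ℝ)
    (θ : ℕ → EuclideanSpace ℝ (Fin d)) (k : ℕ) : EuclideanSpace ℝ (Fin d) :=
  θ k + ((1 / (k : ℝ)) * sgn (y (k + 1) - inner ℝ (θ k) (x k))) • x k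

open Classical in
/-- `θ 1, θ 2, …` are the estimates and `σ 1, σ 2, …` the truncation indices that the sign-gradient
algorithm with expanding truncations computes from the data `x, y`, the initial value `θ₁` and the
truncation bounds `M`. The values `θ 0` and `σ 0` play no role.
With `s = 0` the index `σ (k + 1)` is the number of truncations so far; with `s = 1` it is that
number plus one, so that the indices continue `σ 1 = 1` and `M 0` is never used. -/
structure IsLADRecursion (M : ℕ → ℝ) (s : ℕ) (θ₁ : EuclideanSpace ℝ (Fin d))
    (x : ℕ → EuclideanSpace ℝ (Fin d)) (y : ℕ → ℝ)
    (θ : ℕ → EuclideanSpace ℝ (Fin d)) (σ : ℕ → ℕ) : Prop where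
  theta_one : θ 1 = θ₁
  sigma_one : σ 1 = 1
  theta_succ : ∀ k, 1 ≤ k → θ (k + 1) =
    if ‖ladCandidate x y θ k‖ ≤ M (σ k) then ladCandidate x y θ k else 0
  sigma_succ : ∀ k, 1 ≤ k → σ (k + 1) =
    s + ∑ i ∈ Finset.Icc 1 k, if M (σ i) < ‖ladCandidate x y θ i‖ then 1 else 0

end Algorithm

/-! The proof is a Lyapunov argument for `‖θ k - θ*‖ ^ 2`. Put `t = ⟨θ* - θ k, x k⟩` and let `h t`
be the mean of `sgn (w + t)` (`signDrift`). One step changes the squared distance by `-(2/k) t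
h(t)`, a centred noise term, and `‖x k‖² / k²`. Evenness of the noise density gives `h 0 = 0`,
monotonicity then gives `t h(t) ≥ 0`, and mass near the origin gives `h t > 0` for `t > 0`.

The fresh noise is independent of the past, so the centred terms are martingale differences.
Restricted to times when the estimate lies in a fixed ball, they have variance `O(1/k²)`, hence
their series converges (`ae_exists_tendsto_noise_sum`). All perturbations are then summable along
almost every path. Once the truncation bound is large, a path restarted at the origin cannot reach
it again (`eventually_not_truncated`). After the last truncation the distance to `θ*` converges and
`∑ (1/k) t h(t)` is finite (`summable_and_tendsto_of_descent`).

A positive limit `v` of the distance is impossible (`tendsto_of_summable_drift`). Over a block of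
indices from `K m` to `(K + 1) m` with `K` large the estimate barely moves, so along a subsequence
of blocks the error stays near one fixed nonzero vector `b`. Regressors in a cone about `b` occur
with positive frequency and force `t ≥ η`, so each such block adds a fixed amount to a convergent
series.

Mixing serves only the strong law behind these frequencies and the averages of `‖x k‖`
(`strong_law_of_mixing`). -/

/-! ### Covariance inequalities under φ-mixing. -/

section Covariance

variable {Ω : Type*} {mΩ : MeasurableSpace Ω}

/-- The bounds on events of `m` amount to `P[Y | m] ≤ c` almost surely; a nonnegative `m`-measurable
weight is pulled out of the conditional expectation. This passes from mixing for events to mixing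
for functions of the past. -/
lemma integral_mul_le_of_forall_setIntegral_le {P : Measure Ω} [IsProbabilityMeasure P]
    {m : MeasurableSpace Ω} (hm : m ≤ mΩ) {f Y : Ω → ℝ} {c : ℝ}
    (hf : StronglyMeasurable[m] f) (hf0 : ∀ ω, 0 ≤ f ω) (hfi : Integrable f P)
    (hY : Integrable Y P) (hfY : Integrable (f * Y) P)
    (h : ∀ A, MeasurableSet[m] A → ∫ ω in A, Y ω ∂P ≤ c * P.real A) :
    ∫ ω, f ω * Y ω ∂P ≤ c * ∫ ω, f ω ∂P := by
  have hle : P[Y | m] ≤ᵐ[P] fun _ => c := by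
    refine ae_le_of_ae_le_trim (hm := hm) ?_
    refine ae_le_of_forall_setIntegral_le
      (integrable_condExp.trim hm stronglyMeasurable_condExp) (integrable_const c) ?_
    intro A hA _
    rw [← setIntegral_trim hm stronglyMeasurable_condExp hA, setIntegral_condExp hm hY hA,
      setIntegral_const]
    have := h A hA
    rw [smul_eq_mul, mul_comm, measureReal_def, trim_measurableSet_eq hm hA]
    exact this
  have h1 : ∫ ω, f ω * Y ω ∂P = ∫ ω, (f * P[Y | m]) ω ∂P := by
    exact (integral_condExp hm (f := f * Y)).symm.trans
      (integral_congr_ae (condExp_mul_of_stronglyMeasurable_left hf hfY hY))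
  rw [h1, ← integral_const_mul]
  refine integral_mono_ae ?_ (hfi.const_mul c) ?_
  · exact (integrable_condExp (m := m) (f := f * Y)).congr
      (condExp_mul_of_stronglyMeasurable_left hf hfY hY)
  · filter_upwards [hle] with ω hω
    simp only [Pi.mul_apply]
    rw [mul_comm c]
    exact mul_le_mul_of_nonneg_left hω (hf0 ω)

variable {E : Type*} [MeasurableSpace E]

lemma abs_measure_inter_sub_le_phiMixingCoeff (P : Measure Ω) [IsProbabilityMeasure P]
    (z : ℕ → Ω → E) (n k : ℕ) {A B : Set Ω} (hA : MeasurableSet[sigmaUpTo z n] A)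
    (hB : MeasurableSet[sigmaFrom z (n + k)] B) :
    |P.real (A ∩ B) - P.real A * P.real B| ≤ phiMixingCoeff P z k * P.real A := by
  have key : ∀ A B : Set Ω, |P.real (A ∩ B) - P.real A * P.real B| ≤ P.real A := by
    intro A B
    have h1 : P.real (A ∩ B) ≤ P.real A := measureReal_mono Set.inter_subset_left
    have h2 : (0 : ℝ) ≤ P.real (A ∩ B) := measureReal_nonneg
    have h3 : P.real B ≤ 1 := measureReal_le_one
    have h4 : (0 : ℝ) ≤ P.real B := measureReal_nonneg
    have h5 : (0 : ℝ) ≤ P.real A := measureReal_nonneg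
    rw [abs_le]
    constructor <;> nlinarith
  rcases (measureReal_nonneg (μ := P) (s := A)).eq_or_lt with h0 | h0
  · have := key A B
    rw [← h0] at this ⊢
    simpa using this
  · rw [← div_le_iff₀ h0]
    refine le_csSup ⟨1, ?_⟩ ⟨n, A, B, hA, h0, hB, rfl⟩
    rintro c ⟨n, A, B, -, hA, -, rfl⟩
    rw [div_le_one hA]
    exact key A B

lemma sigmaUpTo_le {z : ℕ → Ω → E} (hz : ∀ k, Measurable (z k)) (n : ℕ) : sigmaUpTo z n ≤ mΩ :=
  iSup₂_le fun i _ => (hz i).comap_le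

lemma comap_le_sigmaUpTo (z : ℕ → Ω → E) {i n : ℕ} (h : i ≤ n) :
    MeasurableSpace.comap (z i) inferInstance ≤ sigmaUpTo z n :=
  le_iSup₂_of_le i h le_rfl

lemma comap_le_sigmaFrom (z : ℕ → Ω → E) {i n : ℕ} (h : n ≤ i) :
    MeasurableSpace.comap (z i) inferInstance ≤ sigmaFrom z n :=
  le_iSup₂_of_le i h le_rfl

/-- Conditioning on the past changes the mean of a bounded function of the future by at most the
mixing coefficient. -/
lemma abs_setIntegral_sub_le_of_mixing (P : Measure Ω) [IsProbabilityMeasure P]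
    {z : ℕ → Ω → E} (hz : ∀ k, Measurable (z k)) (n k : ℕ) {A : Set Ω}
    (hA : MeasurableSet[sigmaUpTo z n] A) {g : E → ℝ} (hg : Measurable g) {b : ℝ} (hb : 0 ≤ b)
    (hg0 : ∀ u, 0 ≤ g u) (hgb : ∀ u, g u ≤ b) :
    |∫ ω in A, g (z (n + k) ω) ∂P - P.real A * ∫ ω, g (z (n + k) ω) ∂P|
      ≤ b * (phiMixingCoeff P z k * P.real A) := by
  have hI : ∀ Q : Measure Ω, IsFiniteMeasure Q → Integrable (fun ω => g (z (n + k) ω)) Q := by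
    intro Q _
    refine Integrable.of_bound (C := b) (hg.comp (hz _)).aestronglyMeasurable ?_
    filter_upwards with ω
    rw [Real.norm_eq_abs, abs_of_nonneg (hg0 _)]
    exact hgb _
  -- Layer-cake formula: `g` is replaced by its superlevel sets, which are future events covered by
  -- the mixing coefficient. The length of `(0, b]` gives the factor `b`.
  have hlayer : ∀ Q : Measure Ω, IsFiniteMeasure Q → ∫ ω, g (z (n + k) ω) ∂Q
      = ∫ t in Set.Ioc 0 b, Q.real {ω | t ≤ g (z (n + k) ω)} := fun Q hQ =>
    (hI Q hQ).integral_eq_integral_Ioc_meas_le (ae_of_all _ fun _ => hg0 _)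
      (ae_of_all _ fun _ => hgb _)
  have hmono : ∀ Q : Measure Ω, IsFiniteMeasure Q →
      IntegrableOn (fun t : ℝ => Q.real {ω | t ≤ g (z (n + k) ω)}) (Set.Ioc 0 b) := by
    intro Q _
    have hanti : Antitone (fun t : ℝ => Q.real {ω | t ≤ g (z (n + k) ω)}) := fun s t hst =>
      measureReal_mono (fun ω (hω : t ≤ _) => hst.trans hω)
    exact (hanti.antitoneOn _).integrableOn_isCompact isCompact_Icc |>.mono_set
      Set.Ioc_subset_Icc_self
  rw [hlayer (P.restrict A) inferInstance, hlayer P inferInstance, ← integral_const_mul,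
    ← integral_sub (hmono _ inferInstance) ((hmono _ inferInstance).const_mul _)]
  have hbound : ∀ t ∈ Set.Ioc (0 : ℝ) b,
      ‖(P.restrict A).real {ω | t ≤ g (z (n + k) ω)} - P.real A * P.real {ω | t ≤ g (z (n + k) ω)}‖
        ≤ phiMixingCoeff P z k * P.real A := by
    intro t _
    have hB : MeasurableSet[sigmaFrom z (n + k)] {ω | t ≤ g (z (n + k) ω)} :=
      comap_le_sigmaFrom z le_rfl _ ⟨{u | t ≤ g u}, measurableSet_le measurable_const hg, rfl⟩
    have hBm : MeasurableSet {ω | t ≤ g (z (n + k) ω)} :=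
      measurableSet_le measurable_const (hg.comp (hz _))
    rw [measureReal_restrict_apply hBm, Set.inter_comm]
    exact abs_measure_inter_sub_le_phiMixingCoeff P z n k hA hB
  refine (norm_setIntegral_le_of_norm_le_const (by simp) hbound).trans (le_of_eq ?_)
  rw [Real.volume_real_Ioc_of_le hb]
  ring

/-- Covariance inequality for `φ`-mixing processes, one factor being bounded. -/
lemma abs_covariance_le_of_mixing_of_bounded (P : Measure Ω) [IsProbabilityMeasure P]
    {z : ℕ → Ω → E} (hz : ∀ k, Measurable (z k)) (n k : ℕ) {f g : E → ℝ}
    (hf : Measurable f) (hf0 : ∀ u, 0 ≤ f u) (hfi : Integrable (fun ω => f (z n ω)) P)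
    (hg : Measurable g) {b : ℝ} (hb : 0 ≤ b) (hg0 : ∀ u, 0 ≤ g u) (hgb : ∀ u, g u ≤ b) :
    |∫ ω, f (z n ω) * g (z (n + k) ω) ∂P - (∫ ω, f (z n ω) ∂P) * ∫ ω, g (z (n + k) ω) ∂P|
      ≤ b * phiMixingCoeff P z k * ∫ ω, f (z n ω) ∂P := by
  have hm := sigmaUpTo_le hz n
  have hgi : Integrable (fun ω => g (z (n + k) ω)) P := by
    refine Integrable.of_bound (C := b) (hg.comp (hz _)).aestronglyMeasurable ?_
    filter_upwards with ω
    rw [Real.norm_eq_abs, abs_of_nonneg (hg0 _)]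
    exact hgb _
  have hfm : StronglyMeasurable[sigmaUpTo z n] (fun ω => f (z n ω)) :=
    Measurable.stronglyMeasurable
      (hf.comp ((comap_measurable (z n)).mono (comap_le_sigmaUpTo z le_rfl) le_rfl))
  have hfg : Integrable ((fun ω => f (z n ω)) * fun ω => g (z (n + k) ω)) P := by
    refine Integrable.mul_bdd (c := b) hfi (hg.comp (hz _)).aestronglyMeasurable ?_
    filter_upwards with ω
    rw [Real.norm_eq_abs, abs_of_nonneg (hg0 _)]
    exact hgb _
  set e := ∫ ω, g (z (n + k) ω) ∂P
  have hset : ∀ A, MeasurableSet[sigmaUpTo z n] A →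
      |∫ ω in A, g (z (n + k) ω) ∂P - P.real A * e| ≤ b * (phiMixingCoeff P z k * P.real A) :=
    fun A hA => abs_setIntegral_sub_le_of_mixing P hz n k hA hg hb hg0 hgb
  -- The two halves of the absolute value come from the one-sided lemma applied to the future factor
  -- and to its negative.
  have h1 := integral_mul_le_of_forall_setIntegral_le (c := e + b * phiMixingCoeff P z k)
    hm hfm (fun _ => hf0 _) hfi hgi hfg (fun A hA => by
      have := (abs_le.1 (hset A hA)).2
      linarith)
  have h2 := integral_mul_le_of_forall_setIntegral_le (c := -e + b * phiMixingCoeff P z k)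
    hm hfm (fun _ => hf0 _) hfi hgi.neg (by simpa [mul_neg] using hfg.neg) (fun A hA => by
      have := (abs_le.1 (hset A hA)).1
      simp only [Pi.neg_apply, integral_neg]
      linarith)
  simp only [Pi.neg_apply, mul_neg, integral_neg] at h2
  rw [abs_le]
  constructor <;> linarith

/-- Covariance inequality for `φ`-mixing processes under a fourth moment. The truncation level `R`
is free. -/
lemma abs_covariance_le_of_mixing (P : Measure Ω) [IsProbabilityMeasure P]
    {z : ℕ → Ω → E} (hz : ∀ k, Measurable (z k)) (n k : ℕ) {g : E → ℝ}
    (hg : Measurable g) (hg0 : ∀ u, 0 ≤ g u) (hg4 : ∀ k, Integrable (fun ω => g (z k ω) ^ 4) P)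
    {K : ℝ} (hK1 : ∀ k, ∫ ω, g (z k ω) ∂P ≤ K) (hK2 : ∀ k, ∫ ω, g (z k ω) ^ 2 ∂P ≤ K)
    (hK4 : ∀ k, ∫ ω, g (z k ω) ^ 4 ∂P ≤ K) {R : ℝ} (hR : 0 < R) :
    |∫ ω, g (z n ω) * g (z (n + k) ω) ∂P - (∫ ω, g (z n ω) ∂P) * ∫ ω, g (z (n + k) ω) ∂P|
      ≤ R * phiMixingCoeff P z k * (∫ ω, g (z n ω) ∂P) + (K + K ^ 2) / R := by
  have hmeas : ∀ k, Measurable (fun ω => g (z k ω)) := fun k => hg.comp (hz k)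
  have hg2 : ∀ k, Integrable (fun ω => g (z k ω) ^ 2) P := fun k => by
    refine ((integrable_const 1).add (hg4 k)).mono' ((hmeas k).pow_const 2).aestronglyMeasurable ?_
    filter_upwards with ω
    rw [Real.norm_eq_abs, abs_of_nonneg (by positivity)]
    simp only [Pi.add_apply]
    nlinarith [sq_nonneg (g (z k ω) ^ 2 - 1), sq_nonneg (g (z k ω) ^ 2)]
  have hg1 : ∀ k, Integrable (fun ω => g (z k ω)) P := fun k => by
    refine ((integrable_const 1).add (hg2 k)).mono' (hmeas k).aestronglyMeasurable ?_
    filter_upwards with ω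
    rw [Real.norm_eq_abs, abs_of_nonneg (hg0 _)]
    simp only [Pi.add_apply]
    nlinarith [sq_nonneg (g (z k ω) - 1), hg0 (z k ω)]
  have hK0 : 0 ≤ K := (integral_nonneg fun _ => hg0 _).trans (hK1 0)
  -- Capping the future factor at `R` makes the bounded case applicable, at the cost `g - gR ≤ g² /
  -- R`.
  let gR : E → ℝ := fun u => min (g u) R
  have hgR : Measurable gR := hg.min measurable_const
  have hgR0 : ∀ u, 0 ≤ gR u := fun u => le_min (hg0 u) hR.le
  have hdiff : ∀ u, g u - gR u ≤ g u ^ 2 / R := by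
    intro u
    rw [le_div_iff₀ hR]
    simp only [gR]
    rcases le_total (g u) R with h | h
    · rw [min_eq_left h]; nlinarith [sq_nonneg (g u)]
    · rw [min_eq_right h]; nlinarith [hg0 u, sq_nonneg R]
  have hdiff0 : ∀ u, 0 ≤ g u - gR u := fun u => sub_nonneg.2 (min_le_left _ _)
  have hgRi : Integrable (fun ω => gR (z (n + k) ω)) P :=
    (hg1 (n + k)).mono' (hgR.comp (hz _)).aestronglyMeasurable (ae_of_all _ fun ω => by
      rw [Real.norm_eq_abs, abs_of_nonneg (hgR0 _)]; exact min_le_left _ _)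
  have hprodR : Integrable (fun ω => g (z n ω) * gR (z (n + k) ω)) P := by
    refine Integrable.mul_bdd (c := R) (hg1 n) (hgR.comp (hz _)).aestronglyMeasurable ?_
    filter_upwards with ω
    rw [Real.norm_eq_abs, abs_of_nonneg (hgR0 _)]
    exact min_le_right _ _
  have hprod : Integrable (fun ω => g (z n ω) * g (z (n + k) ω)) P := by
    refine ((hg2 n).add (hg2 (n + k))).mono' ((hmeas _).mul (hmeas _)).aestronglyMeasurable ?_
    filter_upwards with ω
    rw [Real.norm_eq_abs, abs_of_nonneg (mul_nonneg (hg0 _) (hg0 _))]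
    simp only [Pi.add_apply]
    nlinarith [sq_nonneg (g (z n ω) - g (z (n + k) ω)), sq_nonneg (g (z n ω) + g (z (n + k) ω))]
  have h0 := abs_covariance_le_of_mixing_of_bounded P hz n k hg hg0 (hg1 n) hgR hR.le hgR0
    (fun u => min_le_right _ _)
  have hA0 : 0 ≤ ∫ ω, (g (z n ω) * g (z (n + k) ω) - g (z n ω) * gR (z (n + k) ω)) ∂P :=
    integral_nonneg fun ω => by
      rw [Pi.zero_apply, ← mul_sub]; exact mul_nonneg (hg0 _) (hdiff0 _)
  have hA1 : ∫ ω, (g (z n ω) * g (z (n + k) ω) - g (z n ω) * gR (z (n + k) ω)) ∂P ≤ K / R := by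
    have : ∫ ω, (g (z n ω) * g (z (n + k) ω) - g (z n ω) * gR (z (n + k) ω)) ∂P
        ≤ ∫ ω, (g (z n ω) ^ 2 + g (z (n + k) ω) ^ 4) / (2 * R) ∂P := by
      refine integral_mono (hprod.sub hprodR) (((hg2 n).add (hg4 (n + k))).div_const _) fun ω => ?_
      have h1 := mul_le_mul_of_nonneg_left (hdiff (z (n + k) ω)) (hg0 (z n ω))
      -- The AM-GM inequality separates the two times; the fourth moment is needed here.
      have h2 : g (z n ω) * (g (z (n + k) ω) ^ 2 / R)
          ≤ (g (z n ω) ^ 2 + g (z (n + k) ω) ^ 4) / (2 * R) := by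
        rw [mul_div_assoc', div_le_div_iff₀ hR (by positivity)]
        nlinarith [mul_nonneg hR.le (sq_nonneg (g (z n ω) - g (z (n + k) ω) ^ 2))]
      simp only
      linarith
    refine this.trans ?_
    rw [integral_div, integral_add (hg2 n) (hg4 _), div_le_div_iff₀ (by positivity) hR]
    nlinarith [hK2 n, hK4 (n + k)]
  have hB0 : 0 ≤ ∫ ω, (g (z (n + k) ω) - gR (z (n + k) ω)) ∂P :=
    integral_nonneg fun ω => hdiff0 _
  have hB1 : ∫ ω, (g (z (n + k) ω) - gR (z (n + k) ω)) ∂P ≤ K / R := by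
    have : ∫ ω, (g (z (n + k) ω) - gR (z (n + k) ω)) ∂P ≤ ∫ ω, g (z (n + k) ω) ^ 2 / R ∂P :=
      integral_mono ((hg1 _).sub hgRi) ((hg2 _).div_const _) fun ω => hdiff _
    refine this.trans ?_
    rw [integral_div]
    exact div_le_div_of_nonneg_right (hK2 _) hR.le
  rw [integral_sub hprod hprodR] at hA0 hA1
  rw [integral_sub (hg1 _) hgRi] at hB0 hB1
  have hm0 : 0 ≤ ∫ ω, g (z n ω) ∂P := integral_nonneg fun _ => hg0 _
  have hC0 := mul_nonneg hm0 hB0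
  have hC1 : (∫ ω, g (z n ω) ∂P) * (∫ ω, g (z (n + k) ω) ∂P - ∫ ω, gR (z (n + k) ω) ∂P)
      ≤ K ^ 2 / R := by
    have := mul_le_mul (hK1 n) hB1 hB0 hK0
    calc _ ≤ K * (K / R) := this
      _ = K ^ 2 / R := by ring
  have hKR : 0 ≤ K / R := by positivity
  have hKR2 : 0 ≤ K ^ 2 / R := by positivity
  rw [add_div]
  have h3 := abs_le.1 h0
  rw [abs_le]
  constructor <;> nlinarith [h3.1, h3.2]

end Covariance

/-! ### Strong law of large numbers from decaying covariances. -/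

section StrongLaw

variable {Ω : Type*} {mΩ : MeasurableSpace Ω}

/-- By Tonelli the sum has finite expectation, so it is finite almost surely. -/
lemma ae_summable_of_summable_integral {P : Measure Ω} {F : ℕ → Ω → ℝ}
    (hF : ∀ n, Integrable (F n) P) (hF0 : ∀ n ω, 0 ≤ F n ω)
    (hs : Summable fun n => ∫ ω, F n ω ∂P) : ∀ᵐ ω ∂P, Summable fun n => F n ω := by
  have hlt : ∫⁻ ω, ∑' n, ENNReal.ofReal (F n ω) ∂P ≠ ⊤ := by
    rw [lintegral_tsum fun n => (hF n).aestronglyMeasurable.aemeasurable.ennreal_ofReal]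
    simp_rw [← fun n => ofReal_integral_eq_lintegral_ofReal (hF n) (ae_of_all _ (hF0 n))]
    rw [← ENNReal.ofReal_tsum_of_nonneg (fun n => integral_nonneg (hF0 n)) hs]
    exact ENNReal.ofReal_ne_top
  filter_upwards [ae_lt_top' (AEMeasurable.tsum fun n =>
    (hF n).aestronglyMeasurable.aemeasurable.ennreal_ofReal) hlt] with ω hω
  have := ENNReal.summable_toReal hω.ne
  simpa [ENNReal.toReal_ofReal (hF0 _ ω)] using this

lemma integral_add_sq {P : Measure Ω} {f g : Ω → ℝ} (hf : MemLp f 2 P) (hg : MemLp g 2 P) :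
    ∫ ω, (f ω + g ω) ^ 2 ∂P
      = ∫ ω, f ω ^ 2 ∂P + 2 * ∫ ω, f ω * g ω ∂P + ∫ ω, g ω ^ 2 ∂P := by
  have h2 : Integrable (fun ω => 2 * (f ω * g ω)) P := (hf.integrable_mul hg).const_mul 2
  have h12 : Integrable (fun ω => f ω ^ 2 + 2 * (f ω * g ω)) P := hf.integrable_sq.add h2
  rw [← integral_const_mul, ← integral_add hf.integrable_sq h2,
    ← integral_add h12 hg.integrable_sq]
  refine integral_congr_ae (ae_of_all _ fun ω => ?_)
  ring

/-- The variance of a sum of variables with geometrically decaying covariances grows at most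
linearly. -/
lemma integral_sq_sum_le_of_covariance_le {P : Measure Ω} [IsProbabilityMeasure P] {Y : ℕ → Ω → ℝ}
    (hY : ∀ k, MemLp (Y k) 2 P) {C r : ℝ} (hr0 : 0 ≤ r) (hr1 : r < 1)
    (hC : 0 ≤ C) (hcov : ∀ n k, ∫ ω, Y n ω * Y (n + k) ω ∂P ≤ C * r ^ k) (n : ℕ) :
    ∫ ω, (∑ i ∈ Finset.range n, Y i ω) ^ 2 ∂P ≤ n * (2 * C * (1 - r)⁻¹ + C) := by
  induction n with
  | zero => simp
  | succ n ih =>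
    have hS : MemLp (fun ω => ∑ i ∈ Finset.range n, Y i ω) 2 P :=
      memLp_finsetSum _ fun i _ => hY i
    have hprod : ∀ i, Integrable (fun ω => Y i ω * Y n ω) P := fun i => (hY i).integrable_mul (hY n)
    have hcross : ∫ ω, (∑ i ∈ Finset.range n, Y i ω) * Y n ω ∂P ≤ C * (1 - r)⁻¹ := by
      simp_rw [Finset.sum_mul]
      rw [integral_finsetSum _ fun i _ => hprod i]
      calc ∑ i ∈ Finset.range n, ∫ ω, Y i ω * Y n ω ∂P
          ≤ ∑ i ∈ Finset.range n, C * r ^ (n - i) := by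
            refine Finset.sum_le_sum fun i hi => ?_
            have := hcov i (n - i)
            rwa [Nat.add_sub_cancel' (Finset.mem_range.1 hi).le] at this
        -- The exponent drops by one to match the form reversed by `Finset.sum_range_reflect`.
        _ ≤ ∑ i ∈ Finset.range n, C * r ^ (n - 1 - i) := by
            refine Finset.sum_le_sum fun i hi => mul_le_mul_of_nonneg_left ?_ hC
            exact pow_le_pow_of_le_one hr0 hr1.le (by omega)
        _ = C * ∑ i ∈ Finset.range n, r ^ i := by
            rw [← Finset.mul_sum, Finset.sum_range_reflect (fun i => r ^ i)]
        _ ≤ C * (1 - r)⁻¹ := by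
            refine mul_le_mul_of_nonneg_left ?_ hC
            rw [← tsum_geometric_of_lt_one hr0 hr1]
            exact (summable_geometric_of_lt_one hr0 hr1).sum_le_tsum _ fun i _ => by positivity
    have hsq : ∫ ω, Y n ω ^ 2 ∂P ≤ C := by
      have := hcov n 0
      simpa [sq] using this
    have hexp : ∫ ω, (∑ i ∈ Finset.range (n + 1), Y i ω) ^ 2 ∂P
        = ∫ ω, (∑ i ∈ Finset.range n, Y i ω) ^ 2 ∂P
          + 2 * ∫ ω, (∑ i ∈ Finset.range n, Y i ω) * Y n ω ∂P + ∫ ω, Y n ω ^ 2 ∂P := by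
      simp_rw [Finset.sum_range_succ]
      exact integral_add_sq hS (hY n)
    rw [hexp]
    push_cast
    linarith

/-- Strong law of large numbers for nonnegative variables with common mean and geometrically
decaying covariances. -/
lemma strong_law_of_covariance_le {P : Measure Ω} [IsProbabilityMeasure P] {Z : ℕ → Ω → ℝ}
    (hZ : ∀ k, MemLp (Z k) 2 P) (hZ0 : ∀ k ω, 0 ≤ Z k ω) {e : ℝ} (he : ∀ k, ∫ ω, Z k ω ∂P = e)
    {C r : ℝ} (hr0 : 0 ≤ r) (hr1 : r < 1) (hC : 0 ≤ C)
    (hcov : ∀ n k, ∫ ω, Z n ω * Z (n + k) ω ∂P - e * e ≤ C * r ^ k) :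
    ∀ᵐ ω ∂P, Tendsto (fun n : ℕ => (∑ i ∈ Finset.range n, Z i ω) / n) atTop (𝓝 e) := by
  set B := 2 * C * (1 - r)⁻¹ + C with hB
  have hY : ∀ k, MemLp (fun ω => Z k ω - e) 2 P := fun k => (hZ k).sub (memLp_const e)
  have hYcov : ∀ n k, ∫ ω, (Z n ω - e) * (Z (n + k) ω - e) ∂P ≤ C * r ^ k := by
    intro n k
    have h1 : Integrable (Z n) P := (hZ n).integrable (by norm_num)
    have h2 : Integrable (Z (n + k)) P := (hZ (n + k)).integrable (by norm_num)
    have h3 : Integrable (fun ω => Z n ω * Z (n + k) ω) P := (hZ n).integrable_mul (hZ (n + k))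
    have : ∫ ω, (Z n ω - e) * (Z (n + k) ω - e) ∂P = ∫ ω, Z n ω * Z (n + k) ω ∂P - e * e := by
      calc ∫ ω, (Z n ω - e) * (Z (n + k) ω - e) ∂P
          = ∫ ω, (Z n ω * Z (n + k) ω - e * Z n ω - (e * Z (n + k) ω - e * e)) ∂P := by
            congr 1; ext ω; ring
        _ = _ := by
            have h4 : Integrable (fun ω => Z n ω * Z (n + k) ω - e * Z n ω) P :=
              h3.sub (h1.const_mul e)
            have h5 : Integrable (fun ω => e * Z (n + k) ω - e * e) P :=
              (h2.const_mul e).sub (integrable_const _)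
            rw [integral_sub h4 h5, integral_sub h3 (h1.const_mul e),
              integral_sub (h2.const_mul e) (integrable_const _), integral_const_mul,
              integral_const_mul, he, he]
            simp
    rw [this]
    exact hcov n k
  have hvar := fun n => integral_sq_sum_le_of_covariance_le hY hr0 hr1 hC hYcov n
  -- Along the squares `(j + 1)²` the centred averages have second moment at most `B / (j + 1)²`,
  -- which is summable.
  have hae : ∀ᵐ ω ∂P, Summable fun j : ℕ =>
      ((∑ i ∈ Finset.range ((j + 1) ^ 2), (Z i ω - e)) / ((j + 1 : ℕ) ^ 2 : ℝ)) ^ 2 := by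
    refine ae_summable_of_summable_integral (fun j => ?_) (fun j ω => sq_nonneg _) ?_
    · simp_rw [div_pow]
      exact (memLp_finsetSum _ fun i _ => hY i).integrable_sq.div_const _
    · have hsum : Summable fun j : ℕ => B * (1 / ((j + 1 : ℕ) : ℝ) ^ 2) :=
        ((summable_nat_add_iff 1).2 (Real.summable_one_div_nat_pow.2 one_lt_two)).mul_left B
      refine Summable.of_nonneg_of_le (fun j => integral_nonneg fun ω => sq_nonneg _)
        (fun j => ?_) hsum
      simp_rw [div_pow]
      rw [integral_div, div_le_iff₀ (by positivity)]
      refine (hvar ((j + 1) ^ 2)).trans (le_of_eq ?_)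
      have : ((j + 1 : ℕ) : ℝ) ≠ 0 := by positivity
      field_simp
      push_cast
      ring
  filter_upwards [hae] with ω hω
  -- Nonnegative summands make the partial sums monotone, so it suffices to converge along a
  -- subsequence with consecutive ratios tending to 1, such as the squares.
  refine tendsto_div_of_monotone_of_exists_subseq_tendsto_div _ e ?_ fun a ha => ?_
  · exact fun m n hmn => Finset.sum_le_sum_of_subset_of_nonneg
      (Finset.range_mono hmn) fun i _ _ => hZ0 i ω
  refine ⟨fun j => (j + 1) ^ 2, ?_, ?_, ?_⟩
  · have h1 : Tendsto (fun j : ℕ => (1 + 1 / ((j : ℝ) + 1)) ^ 2) atTop (𝓝 ((1 + 0) ^ 2)) :=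
      (tendsto_const_nhds.add tendsto_one_div_add_atTop_nhds_zero_nat).pow 2
    have h2 : ∀ᶠ j : ℕ in atTop, (1 + 1 / ((j : ℝ) + 1)) ^ 2 < a :=
      h1.eventually_lt_const (by simpa using ha)
    filter_upwards [h2] with j hj
    have hj0 : (0 : ℝ) < (j : ℝ) + 1 := by positivity
    have : ((j : ℝ) + 1 + 1) ^ 2 = (1 + 1 / ((j : ℝ) + 1)) ^ 2 * ((j : ℝ) + 1) ^ 2 := by
      field_simp
    push_cast
    rw [this]
    exact mul_le_mul_of_nonneg_right hj.le (by positivity)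
  · exact (tendsto_pow_atTop two_ne_zero).comp (tendsto_add_atTop_nat 1)
  · have h0 := hω.tendsto_atTop_zero.sqrt
    simp_rw [Real.sqrt_sq_eq_abs, Real.sqrt_zero] at h0
    have h1 := ((tendsto_zero_iff_abs_tendsto_zero _).2 h0).add_const e
    rw [zero_add] at h1
    refine h1.congr fun j => ?_
    have : ((j + 1 : ℕ) : ℝ) ≠ 0 := by positivity
    rw [Finset.sum_sub_distrib, Finset.sum_const, Finset.card_range]
    simp only [nsmul_eq_mul]
    push_cast at this ⊢
    field_simp
    ring

/-- Strong law of large numbers for nonnegative functions of a geometrically `φ`-mixing,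
identically distributed process. -/
lemma strong_law_of_mixing {E : Type*} [MeasurableSpace E] {P : Measure Ω} [IsProbabilityMeasure P]
    {z : ℕ → Ω → E} (hz : ∀ k, Measurable (z k)) (hlaw : ∀ k, P.map (z k) = P.map (z 0))
    (hmix : ∃ μ ρ : ℝ, 0 < μ ∧ 0 < ρ ∧ ρ < 1 ∧ ∀ k, phiMixingCoeff P z k ≤ μ * ρ ^ k)
    {g : E → ℝ} (hg : Measurable g) (hg0 : ∀ u, 0 ≤ g u)
    (hg4 : Integrable (fun ω => g (z 0 ω) ^ 4) P) :
    ∀ᵐ ω ∂P, Tendsto (fun n : ℕ => (∑ i ∈ Finset.range n, g (z i ω)) / n) atTop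
      (𝓝 (∫ ω, g (z 0 ω) ∂P)) := by
  have hid : ∀ k, IdentDistrib (z k) (z 0) P P := fun k =>
    ⟨(hz k).aemeasurable, (hz 0).aemeasurable, hlaw k⟩
  have hI : ∀ (p k : ℕ), ∫ ω, g (z k ω) ^ p ∂P = ∫ ω, g (z 0 ω) ^ p ∂P := fun p k =>
    ((hid k).comp (hg.pow_const p)).integral_eq
  have hint1 : ∀ k : ℕ, ∫ ω, g (z k ω) ∂P = ∫ ω, g (z 0 ω) ∂P := fun k =>
    ((hid k).comp hg).integral_eq
  have hg4' : ∀ k, Integrable (fun ω => g (z k ω) ^ 4) P := fun k =>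
    ((hid k).comp (hg.pow_const 4)).integrable_iff.2 hg4
  obtain ⟨μ, ρ, hμ, hρ0, hρ1, hφ⟩ := hmix
  set e := ∫ ω, g (z 0 ω) ∂P
  have he0 : 0 ≤ e := integral_nonneg fun _ => hg0 _
  set K := max e (max (∫ ω, g (z 0 ω) ^ 2 ∂P) (∫ ω, g (z 0 ω) ^ 4 ∂P))
  have hK0 : 0 ≤ K := he0.trans (le_max_left _ _)
  set r := Real.sqrt ρ with hr
  have hr0 : 0 < r := Real.sqrt_pos.2 hρ0
  have hr1 : r < 1 := by rw [hr, Real.sqrt_lt' one_pos]; simpa using hρ1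
  have hrρ : ρ = r ^ 2 := (Real.sq_sqrt hρ0.le).symm
  refine strong_law_of_covariance_le (C := μ * e + (K + K ^ 2)) (fun k => ?_) (fun k ω => hg0 _)
    hint1 hr0.le hr1 (by positivity) fun n k => ?_
  · refine (memLp_two_iff_integrable_sq (hg.comp (hz k)).aestronglyMeasurable).2 ?_
    refine ((integrable_const 1).add (hg4' k)).mono'
      ((hg.comp (hz k)).pow_const 2).aestronglyMeasurable ?_
    filter_upwards with ω
    rw [Real.norm_eq_abs, abs_of_nonneg (by positivity)]
    simp only [Pi.add_apply, Function.comp_apply]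
    nlinarith [sq_nonneg (g (z k ω) ^ 2 - 1), sq_nonneg (g (z k ω) ^ 2)]
  -- With `r = √ρ`, the choice `R = r⁻ᵏ` balances the two errors: `R ρᵏ` and `1 / R` both equal
  -- `rᵏ`.
  · have h := abs_covariance_le_of_mixing P hz n k hg hg0 hg4' (K := K)
      (fun j => (hint1 j).trans_le (le_max_left _ _))
      (fun j => (hI 2 j).trans_le ((le_max_left _ _).trans (le_max_right _ _)))
      (fun j => (hI 4 j).trans_le ((le_max_right _ _).trans (le_max_right _ _)))
      (R := (r ^ k)⁻¹) (by positivity)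
    rw [hint1, hint1, div_inv_eq_mul] at h
    have h2 : (r ^ k)⁻¹ * phiMixingCoeff P z k * e ≤ μ * e * r ^ k := by
      have h3 : (r ^ k)⁻¹ * phiMixingCoeff P z k ≤ (r ^ k)⁻¹ * (μ * ρ ^ k) :=
        mul_le_mul_of_nonneg_left (hφ k) (by positivity)
      have h4 : (r ^ k)⁻¹ * (μ * ρ ^ k) = μ * r ^ k := by
        rw [hrρ, ← pow_mul, mul_comm 2 k, pow_mul]
        field_simp
      nlinarith
    have := (le_abs_self _).trans h
    linarith

end StrongLaw

/-! ### Convergence of square-integrable martingale series. -/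

section Martingale

variable {Ω : Type*} {mΩ : MeasurableSpace Ω}

/-- A series of square-integrable martingale differences with summable second moments converges
almost surely. -/
lemma ae_exists_tendsto_sum_of_orthogonal {P : Measure Ω} [IsProbabilityMeasure P]
    (ℱ : Filtration ℕ mΩ) {D : ℕ → Ω → ℝ} (hDm : ∀ n, Measurable[ℱ (n + 1)] (D n))
    (hD : ∀ n, MemLp (D n) 2 P)
    (horth : ∀ n (f : Ω → ℝ), Measurable[ℱ n] f → MemLp f 2 P → ∫ ω, f ω * D n ω ∂P = 0)
    (hsum : Summable fun n => ∫ ω, D n ω ^ 2 ∂P) :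
    ∀ᵐ ω ∂P, ∃ c, Tendsto (fun n => ∑ i ∈ Finset.range n, D i ω) atTop (𝓝 c) := by
  let S : ℕ → Ω → ℝ := fun n ω => ∑ i ∈ Finset.range n, D i ω
  have hSm : ∀ n, Measurable[ℱ n] (S n) := fun n =>
    Finset.measurable_fun_sum _ fun i hi =>
      (hDm i).mono (ℱ.mono (Nat.succ_le_of_lt (Finset.mem_range.1 hi))) le_rfl
  have hS2 : ∀ n, MemLp (S n) 2 P := fun n => memLp_finsetSum _ fun i _ => hD i
  have hSi : ∀ n, Integrable (S n) P := fun n => (hS2 n).integrable (by norm_num)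
  have hDi : ∀ n, Integrable (D n) P := fun n => (hD n).integrable (by norm_num)
  have hsucc : ∀ n ω, S (n + 1) ω = S n ω + D n ω := fun n ω => Finset.sum_range_succ _ _
  have hmart : Martingale S ℱ P := by
    refine martingale_of_setIntegral_eq_succ (fun n => (hSm n).stronglyMeasurable) hSi ?_
    intro n A hA
    have hAm := ℱ.le n A hA
    have h0 := horth n (A.indicator 1) (measurable_const.indicator hA)
      ((memLp_const (1 : ℝ)).indicator hAm)
    have h1 : ∫ ω in A, D n ω ∂P = 0 := by
      rw [← integral_indicator hAm, ← h0]
      congr 1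
      ext ω
      by_cases h : ω ∈ A <;> simp [h]
    simp_rw [hsucc]
    rw [integral_add (hSi n).integrableOn (hDi n).integrableOn, h1, add_zero]
  have hvar : ∀ n, ∫ ω, S n ω ^ 2 ∂P = ∑ i ∈ Finset.range n, ∫ ω, D i ω ^ 2 ∂P := by
    intro n
    induction n with
    | zero => simp [S]
    | succ n ih =>
      simp_rw [hsucc]
      rw [integral_add_sq (hS2 n) (hD n), horth n _ (hSm n) (hS2 n), ih, Finset.sum_range_succ]
      ring
  set B := ∑' n, ∫ ω, D n ω ^ 2 ∂P
  have hB : ∀ n, ∫ ω, S n ω ^ 2 ∂P ≤ B := fun n =>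
    (hvar n).trans_le (hsum.sum_le_tsum _ fun i _ => integral_nonneg fun _ => sq_nonneg _)
  -- Orthogonality bounds the partial sums in `L²`; `|S| ≤ 1 + S²` turns this into the `L¹` bound
  -- required by Doob's theorem.
  refine hmart.submartingale.exists_ae_tendsto_of_bdd (R := (1 + B).toNNReal) fun n => ?_
  rw [eLpNorm_one_eq_lintegral_enorm, ← ofReal_integral_norm_eq_lintegral_enorm (hSi n)]
  refine ENNReal.ofReal_le_ofReal ?_
  calc ∫ ω, ‖S n ω‖ ∂P ≤ ∫ ω, (1 + S n ω ^ 2) ∂P := by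
        refine integral_mono (hSi n).norm ((integrable_const 1).add (hS2 n).integrable_sq) ?_
        intro ω
        have h := sq_abs (S n ω)
        simp only [Real.norm_eq_abs]
        nlinarith [sq_nonneg (|S n ω| - 1), abs_nonneg (S n ω)]
    _ ≤ 1 + B := by
        rw [integral_add (integrable_const 1) (hS2 n).integrable_sq]
        simpa using hB n

end Martingale

/-! ### The mean of the sign of shifted noise. -/

section SignDrift

lemma measurable_sgn : Measurable sgn :=
  Measurable.ite (measurableSet_le measurable_const measurable_id) measurable_const measurable_const

lemma abs_sgn (t : ℝ) : |sgn t| = 1 := by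
  unfold sgn
  split_ifs <;> simp

lemma sgn_sq (t : ℝ) : sgn t ^ 2 = 1 := by
  rw [← sq_abs, abs_sgn, one_pow]

lemma monotone_sgn : Monotone sgn := by
  intro s t hst
  unfold sgn
  split_ifs <;> linarith

/-- The mean of `sgn (w + t)` for noise `w` with law `ν`. -/
noncomputable def signDrift (ν : Measure ℝ) (t : ℝ) : ℝ := ∫ s, sgn (s + t) ∂ν

lemma integrable_sgn_add (ν : Measure ℝ) [IsFiniteMeasure ν] (t : ℝ) :
    Integrable (fun s => sgn (s + t)) ν :=
  Integrable.of_bound (C := 1)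
    (measurable_sgn.comp (measurable_id.add_const t)).aestronglyMeasurable
    (ae_of_all _ fun s => by rw [Real.norm_eq_abs, abs_sgn])

lemma monotone_signDrift (ν : Measure ℝ) [IsFiniteMeasure ν] : Monotone (signDrift ν) :=
  fun s t hst => integral_mono (integrable_sgn_add ν s) (integrable_sgn_add ν t)
    fun u => monotone_sgn (by linarith)

lemma abs_signDrift_le (ν : Measure ℝ) [IsProbabilityMeasure ν] (t : ℝ) : |signDrift ν t| ≤ 1 := by
  have := norm_integral_le_of_norm_le_const (μ := ν) (f := fun s => sgn (s + t)) (C := 1)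
    (ae_of_all _ fun s => by rw [Real.norm_eq_abs, abs_sgn])
  simpa [signDrift] using this

variable {f : ℝ → ℝ} {ν : Measure ℝ}

/-- Reflection preserves `ν`, and `sgn` is odd off the origin, a null set because `ν` has a density.
-/
lemma signDrift_zero_of_even [IsProbabilityMeasure ν] (hf : Measurable f)
    (hν : ν = volume.withDensity fun s => ENNReal.ofReal (f s)) (heven : ∀ s, f (-s) = f s) :
    signDrift ν 0 = 0 := by
  have hneg : MeasurePreserving (fun s : ℝ => -s) ν ν := by
    refine ⟨measurable_neg, ?_⟩
    ext A hA
    rw [Measure.map_apply measurable_neg hA, hν, withDensity_apply _ hA,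
      withDensity_apply _ (measurable_neg hA), ← lintegral_indicator hA,
      ← lintegral_indicator (measurable_neg hA)]
    rw [← (Measure.measurePreserving_neg (volume : Measure ℝ)).lintegral_comp
      (hf.ennreal_ofReal.indicator hA)]
    refine lintegral_congr fun s => ?_
    simp only [Set.indicator, heven]
    rfl
  have hzero : ∀ᵐ s ∂ν, s ≠ 0 := by
    rw [hν]
    exact (withDensity_absolutelyContinuous _ _).ae_le (Measure.ae_ne volume (0 : ℝ))
  have h1 : ∫ s, sgn (-s) ∂ν = ∫ s, sgn s ∂ν :=
    hneg.integral_comp (MeasurableEquiv.neg ℝ).measurableEmbedding sgn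
  have h2 : ∫ s, sgn (-s) ∂ν = -∫ s, sgn s ∂ν := by
    rw [← integral_neg]
    refine integral_congr_ae ?_
    filter_upwards [hzero] with s hs
    unfold sgn
    rcases lt_or_gt_of_ne hs with h | h
    · rw [if_pos (by linarith), if_neg (by linarith)]; simp
    · rw [if_neg (by linarith), if_pos (by linarith)]
  unfold signDrift
  simp only [add_zero]
  linarith

/-- Shifting by `t` never lowers the sign and raises it from `-1` to `1` just left of the origin,
where continuity of `f` at 0 provides positive mass. -/
lemma signDrift_pos [IsProbabilityMeasure ν] (hf : Measurable f)
    (hν : ν = volume.withDensity fun s => ENNReal.ofReal (f s)) (heven : ∀ s, f (-s) = f s)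
    (hpos : 0 < f 0) (hcont : ContinuousAt f 0) {t : ℝ} (ht : 0 < t) : 0 < signDrift ν t := by
  obtain ⟨δ, hδ, hδf⟩ := Metric.eventually_nhds_iff.1 (hcont.eventually (lt_mem_nhds hpos))
  set A := Set.Ioo (-(min δ t)) 0 with hA
  have hAν : 0 < ν A := by
    rw [pos_iff_ne_zero, hν, Ne, withDensity_apply_eq_zero hf.ennreal_ofReal]
    have hsub : A ⊆ {s | ENNReal.ofReal (f s) ≠ 0} ∩ A := by
      refine fun s hs => ⟨?_, hs⟩
      have : 0 < f s := hδf (by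
        rw [Real.dist_eq, sub_zero, abs_of_neg hs.2]
        have := hs.1
        linarith [min_le_left δ t])
      simpa using this
    intro h0
    have : volume A = 0 := measure_mono_null hsub h0
    rw [hA, Real.volume_Ioo] at this
    simp at this
    rcases this with h | h <;> linarith
  rw [← signDrift_zero_of_even hf hν heven, ← sub_pos]
  unfold signDrift
  rw [← integral_sub (integrable_sgn_add ν t) (integrable_sgn_add ν 0)]
  rw [integral_pos_iff_support_of_nonneg
    (fun s => sub_nonneg.2 (monotone_sgn (by linarith)))
    ((integrable_sgn_add ν t).sub (integrable_sgn_add ν 0))]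
  refine hAν.trans_le (measure_mono fun s hs => ?_)
  have h1 : sgn (s + t) = 1 := if_pos (by have := hs.1; linarith [min_le_right δ t])
  have h2 : sgn (s + 0) = -1 := if_neg (by have := hs.2; linarith)
  rw [Function.mem_support, h1, h2]
  norm_num

/-- `sgn (W + t)` has conditional mean `signDrift` given a `σ`-algebra that is independent of the
noise `W` and makes `t` measurable. -/
lemma integral_mul_sgn_sub_signDrift {Ω : Type*} {m mΩ : MeasurableSpace Ω} {P : Measure Ω}
    [IsProbabilityMeasure P] (hm : m ≤ mΩ) {W : Ω → ℝ} (hW : Measurable W)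
    (hind : Indep (MeasurableSpace.comap W inferInstance) m P) {a t : Ω → ℝ}
    (ha : Measurable[m] a) (ht : Measurable[m] t) (hai : Integrable a P) :
    ∫ ω, a ω * (sgn (W ω + t ω) - signDrift (P.map W) (t ω)) ∂P = 0 := by
  have hpm : Measurable[m] (fun ω => (a ω, t ω)) := ha.prodMk ht
  have hp : Measurable (fun ω => (a ω, t ω)) := hpm.mono hm le_rfl
  have hif : W ⟂ᵢ[P] (fun ω => (a ω, t ω)) :=
    indep_of_indep_of_le_right hind hpm.comap_le
  have : IsProbabilityMeasure (P.map W) := Measure.isProbabilityMeasure_map hW.aemeasurable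
  have : IsProbabilityMeasure (P.map (fun ω => (a ω, t ω))) :=
    Measure.isProbabilityMeasure_map hp.aemeasurable
  have hmap := (indepFun_iff_map_prod_eq_prod_map_map hW.aemeasurable hp.aemeasurable).1 hif
  let F : ℝ × (ℝ × ℝ) → ℝ := fun v => v.2.1 * (sgn (v.1 + v.2.2) - signDrift (P.map W) v.2.2)
  have hF : Measurable F :=
    (measurable_snd.fst).mul ((measurable_sgn.comp (measurable_fst.add measurable_snd.snd)).sub
      ((monotone_signDrift _).measurable.comp measurable_snd.snd))
  have hFi : Integrable F ((P.map W).prod (P.map fun ω => (a ω, t ω))) := by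
    rw [← hmap, integrable_map_measure hF.aestronglyMeasurable (hW.prodMk hp).aemeasurable]
    refine (hai.norm.const_mul 2).mono' (hF.comp (hW.prodMk hp)).aestronglyMeasurable ?_
    filter_upwards with ω
    simp only [F, Function.comp_apply, norm_mul, Real.norm_eq_abs]
    rw [mul_comm]
    refine mul_le_mul_of_nonneg_right ?_ (abs_nonneg _)
    refine (abs_sub _ _).trans ?_
    rw [abs_sgn]
    linarith [abs_signDrift_le (P.map W) (t ω)]
  have h1 : ∫ ω, a ω * (sgn (W ω + t ω) - signDrift (P.map W) (t ω)) ∂P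
      = ∫ v, F v ∂((P.map W).prod (P.map fun ω => (a ω, t ω))) := by
    rw [← hmap, integral_map (hW.prodMk hp).aemeasurable hF.aestronglyMeasurable]
  -- Independence makes the joint law a product. Integrating first over the noise, with `(a, t)`
  -- frozen, gives zero.
  rw [h1, integral_prod_symm _ hFi]
  refine integral_eq_zero_of_ae (ae_of_all _ fun p => ?_)
  simp only [F, Pi.zero_apply]
  rw [integral_const_mul, integral_sub (integrable_sgn_add _ _) (integrable_const _)]
  simp [signDrift]

end SignDrift

/-! ### Deterministic lemmas on descent, truncation and excitation. -/

section Deterministic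

lemma tendsto_sum_range_succ_div {a : ℕ → ℝ} {e : ℝ}
    (h : Tendsto (fun n : ℕ => (∑ i ∈ Finset.range n, a i) / n) atTop (𝓝 e)) :
    Tendsto (fun n : ℕ => (∑ i ∈ Finset.range n, a (i + 1)) / n) atTop (𝓝 e) := by
  have h1 := h.comp (tendsto_add_atTop_nat 1)
  have h2 : Tendsto (fun n : ℕ => 1 + 1 / (n : ℝ)) atTop (𝓝 (1 + 0)) :=
    tendsto_const_nhds.add tendsto_one_div_atTop_nhds_zero_nat
  have h3 := (h1.mul h2).sub (tendsto_one_div_atTop_nhds_zero_nat.const_mul (a 0))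
  simp only [add_zero, mul_one, mul_zero, sub_zero] at h3
  refine h3.congr' ?_
  filter_upwards [eventually_gt_atTop 0] with n hn
  have hn' : (n : ℝ) ≠ 0 := by positivity
  have hn1 : (n : ℝ) + 1 ≠ 0 := by positivity
  simp only [Function.comp_apply, Finset.sum_range_succ', Nat.cast_add, Nat.cast_one]
  field_simp
  ring

/-- Convergence of averages implies convergence of the averages over the blocks
`[K m, (K + 1) m)`. -/
lemma tendsto_sum_block_div {a : ℕ → ℝ} {e : ℝ}
    (h : Tendsto (fun n : ℕ => (∑ i ∈ Finset.range n, a i) / n) atTop (𝓝 e)) {K : ℕ} (hK : 0 < K) :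
    Tendsto (fun m : ℕ => (∑ i ∈ Finset.Ico (K * m) ((K + 1) * m), a i) / m) atTop (𝓝 e) := by
  have hsub : ∀ K : ℕ, 0 < K →
      Tendsto (fun m : ℕ => (∑ i ∈ Finset.range (K * m), a i) / m) atTop (𝓝 (K * e)) := by
    intro K hK
    have h1 := (h.comp (tendsto_id.const_mul_atTop' hK)).const_mul (K : ℝ)
    refine h1.congr fun m => ?_
    have hK' : (K : ℝ) ≠ 0 := by positivity
    simp only [Function.comp_apply, id, Nat.cast_mul]
    rcases eq_or_ne (m : ℝ) 0 with hm | hm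
    · simp [hm]
    · field_simp
  have h2 := (hsub (K + 1) K.succ_pos).sub (hsub K hK)
  have h3 : ((K + 1 : ℕ) : ℝ) * e - K * e = e := by push_cast; ring
  rw [h3] at h2
  refine h2.congr fun m => ?_
  rw [Finset.sum_Ico_eq_sub _ (Nat.mul_le_mul_right m K.le_succ), sub_div]

lemma tendsto_sum_block_zero {p : ℕ → ℝ} (hp : Summable p) {K : ℕ} (hK : 0 < K) :
    Tendsto (fun m : ℕ => ∑ i ∈ Finset.Ico (K * m) ((K + 1) * m), p i) atTop (𝓝 0) := by
  have h := hp.hasSum.tendsto_sum_nat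
  have h1 := (h.comp (tendsto_id.const_mul_atTop' K.succ_pos)).sub
    (h.comp (tendsto_id.const_mul_atTop' hK))
  rw [sub_self] at h1
  refine h1.congr fun m => ?_
  simp only [Function.comp_apply, id]
  rw [Finset.sum_Ico_eq_sub _ (Nat.mul_le_mul_right m K.le_succ)]

/-- The quantity `V n + ∑ p - ∑ b` is eventually constant. As `V ≥ 0` and the sums of `b` are
bounded, the sums of `p` are bounded too, and everything converges. -/
lemma summable_and_tendsto_of_descent {V p b : ℕ → ℝ} (hV0 : ∀ n, 0 ≤ V n) (hp0 : ∀ n, 0 ≤ p n)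
    (hstep : ∀ᶠ n in atTop, V (n + 1) = V n - p n + b n)
    (hb : ∃ l, Tendsto (fun n => ∑ i ∈ Finset.range n, b i) atTop (𝓝 l)) :
    Summable p ∧ ∃ v, Tendsto V atTop (𝓝 v) := by
  obtain ⟨l, hl⟩ := hb
  obtain ⟨N, hN⟩ := eventually_atTop.1 hstep
  have hid : ∀ n, N ≤ n → V n + ∑ i ∈ Finset.range n, p i - ∑ i ∈ Finset.range n, b i
      = V N + ∑ i ∈ Finset.range N, p i - ∑ i ∈ Finset.range N, b i := by
    intro n hn
    induction n, hn using Nat.le_induction with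
    | base => rfl
    | succ n hn ih =>
      rw [Finset.sum_range_succ, Finset.sum_range_succ, hN n hn, ← ih]
      ring
  set Q := V N + ∑ i ∈ Finset.range N, p i - ∑ i ∈ Finset.range N, b i
  obtain ⟨B, hB⟩ := hl.bddAbove_range
  have hp : Summable p := by
    refine summable_of_sum_range_le (c := Q + B) hp0 fun n => ?_
    have h1 := hid (max n N) (le_max_right _ _)
    have h2 : ∑ i ∈ Finset.range (max n N), b i ≤ B := hB ⟨_, rfl⟩
    have h3 : ∑ i ∈ Finset.range n, p i ≤ ∑ i ∈ Finset.range (max n N), p i :=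
      Finset.sum_le_sum_of_subset_of_nonneg (Finset.range_mono (le_max_left _ _))
        fun i _ _ => hp0 i
    linarith [hV0 (max n N)]
  refine ⟨hp, Q + l - ∑' i, p i, ?_⟩
  refine ((hl.const_add Q).sub hp.hasSum.tendsto_sum_nat).congr' ?_
  filter_upwards [eventually_ge_atTop N] with n hn
  linarith [hid n hn]

variable {E : Type*} [NormedAddCommGroup E]

/-- A recursion with expanding truncations that resets to the origin is truncated only finitely
often if its perturbations are summable while it stays in a ball. -/
lemma eventually_not_truncated {ϑ c : ℕ → E} {L b : ℕ → ℝ} {a : E} {C : ℝ} (hC : ‖a‖ + 1 ≤ C)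
    (hstep : ∀ n, ‖ϑ n - a‖ ≤ C → ‖c n - a‖ ^ 2 ≤ ‖ϑ n - a‖ ^ 2 + b n)
    (hb : ∃ l, Tendsto (fun n => ∑ i ∈ Finset.range n, b i) atTop (𝓝 l))
    (hkeep : ∀ n, ‖c n‖ ≤ L n → ϑ (n + 1) = c n) (hreset : ∀ n, L n < ‖c n‖ → ϑ (n + 1) = 0)
    (hL : (∃ᶠ n in atTop, L n < ‖c n‖) → Tendsto L atTop atTop) :
    ∀ᶠ n in atTop, ‖c n‖ ≤ L n := by
  by_contra hcon
  have hfreq : ∃ᶠ n in atTop, L n < ‖c n‖ := by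
    rw [not_eventually] at hcon
    exact hcon.mono fun n hn => not_le.1 hn
  obtain ⟨l, hl⟩ := hb
  set S : ℕ → ℝ := fun n => ∑ i ∈ Finset.range n, b i with hS
  -- Points within `‖a‖ + 1` of `a` have norm at most `2‖a‖ + 1`. The tolerance `1 / 2` keeps any
  -- two late partial sums of `b` within 1 of each other.
  have hev : ∀ᶠ n in atTop, (2 * ‖a‖ + 1 ≤ L n) ∧ |S n - l| < 1 / 2 := by
    refine ((hL hfreq).eventually_ge_atTop _).and ?_
    have := Metric.tendsto_nhds.1 hl (1 / 2) (by norm_num)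
    simpa [Real.dist_eq] using this
  obtain ⟨N, hN⟩ := eventually_atTop.1 hev
  obtain ⟨k, hkN, hk⟩ := frequently_atTop.1 hfreq N
  have hsmall : ∀ m n, N ≤ m → N ≤ n → S m - S n ≤ 1 := by
    intro m n hm hn
    have h1 := abs_lt.1 (hN m hm).2
    have h2 := abs_lt.1 (hN n hn).2
    linarith [h1.2, h2.1]
  have ha0 := norm_nonneg a
  have hnorm : ∀ u : E, ‖u - a‖ ^ 2 ≤ ‖a‖ ^ 2 + 1 → ‖u - a‖ ≤ ‖a‖ + 1 := fun u hu =>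
    le_of_sq_le_sq (by nlinarith) (by linarith)
  -- After the reset at time `k` the squared distance starts at `‖a‖²` and gains at most 1. It stays
  -- below `(‖a‖ + 1)²`, so `hstep` remains applicable and no later candidate is rejected.
  have hcand : ∀ n, k + 1 ≤ n → ‖ϑ n - a‖ ^ 2 ≤ ‖a‖ ^ 2 + (S n - S (k + 1)) →
      ‖c n - a‖ ^ 2 ≤ ‖a‖ ^ 2 + (S (n + 1) - S (k + 1)) ∧ ‖c n‖ ≤ L n := by
    intro n hn h
    have h1 := hsmall n (k + 1) (by omega) (by omega)
    have h2 := hstep n ((hnorm _ (by linarith)).trans hC)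
    have h3 : S (n + 1) = S n + b n := Finset.sum_range_succ _ _
    have h4 := hsmall (n + 1) (k + 1) (by omega) (by omega)
    have h5 : ‖c n - a‖ ^ 2 ≤ ‖a‖ ^ 2 + (S (n + 1) - S (k + 1)) := by linarith
    have h6 := hnorm _ (h5.trans (by linarith))
    refine ⟨h5, ?_⟩
    have h7 : ‖c n‖ ≤ ‖c n - a‖ + ‖a‖ := by simpa using norm_add_le (c n - a) a
    linarith [(hN n (by omega)).1]
  have hinv : ∀ n, k + 1 ≤ n → ‖ϑ n - a‖ ^ 2 ≤ ‖a‖ ^ 2 + (S n - S (k + 1)) := by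
    intro n hn
    induction n, hn using Nat.le_induction with
    | base => rw [hreset k hk]; simp
    | succ n hn ih =>
      obtain ⟨h1, h2⟩ := hcand n hn ih
      rwa [hkeep n h2]
  obtain ⟨j, hj, hj'⟩ := frequently_atTop.1 hfreq (k + 1)
  exact absurd (hcand j hj (hinv j hj)).2 (not_le.2 hj')

lemma dist_le_sum_block {ϑ : ℕ → E} {s : ℕ → ℝ} {m n : ℕ}
    (hs0 : ∀ i, 0 ≤ s i) (h : ∀ i, m ≤ i → ‖ϑ (i + 1) - ϑ i‖ ≤ s i) {k : ℕ}
    (hk : k ∈ Finset.Ico m n) : ‖ϑ k - ϑ m‖ ≤ ∑ i ∈ Finset.Ico m n, s i := by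
  obtain ⟨hmk, hkn⟩ := Finset.mem_Ico.1 hk
  have h1 : dist (ϑ m) (ϑ k) ≤ ∑ i ∈ Finset.Ico m k, s i :=
    dist_le_Ico_sum_of_dist_le hmk fun {i} hi _ => by
      rw [dist_eq_norm, norm_sub_rev]; exact h i hi
  rw [dist_eq_norm, norm_sub_rev] at h1
  exact h1.trans (Finset.sum_le_sum_of_subset_of_nonneg
    (Finset.Ico_subset_Ico_right hkn.le) fun i _ _ => hs0 i)

/-- If the distance of `ϑ n` to `a` converges and the weighted drift along the regressors is
summable, then the limit of the distance is zero, provided every direction is excited with positive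
frequency. -/
lemma tendsto_of_summable_drift [InnerProductSpace ℝ E] [ProperSpace E] {ϑ X : ℕ → E} {a : E} {h : ℝ → ℝ} {e v : ℝ}
    (hmono : Monotone h) (hpos : ∀ t, 0 < t → 0 < h t) (hth : ∀ t, 0 ≤ t * h t)
    (hstep : ∀ᶠ n in atTop, ‖ϑ (n + 1) - ϑ n‖ ≤ ‖X n‖ / (n + 1))
    (hv : Tendsto (fun n => ‖ϑ n - a‖) atTop (𝓝 v))
    (hsum : Summable fun n : ℕ => 1 / ((n : ℝ) + 1) *
      (inner ℝ (a - ϑ n) (X n) * h (inner ℝ (a - ϑ n) (X n))))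
    (havg : Tendsto (fun n : ℕ => (∑ i ∈ Finset.range n, ‖X i‖) / n) atTop (𝓝 e))
    {A : Set E} (hA : Dense A)
    (hfreq : ∀ b ∈ A, b ≠ 0 → ∃ η > 0, ∃ π > 0, Tendsto (fun n : ℕ => (∑ i ∈ Finset.range n,
      {u | ‖b‖ / 2 * ‖u‖ + η < inner ℝ b u}.indicator (fun _ => (1 : ℝ)) (X i)) / n)
      atTop (𝓝 π)) :
    Tendsto ϑ atTop (𝓝 a) := by
  have hv0 : 0 ≤ v := ge_of_tendsto' hv fun n => norm_nonneg _
  rcases hv0.eq_or_lt with hv0 | hv0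
  · rw [tendsto_iff_norm_sub_tendsto_zero, hv0]; exact hv
  exfalso
  have he0 : 0 ≤ e := ge_of_tendsto' havg fun n => by positivity
  -- Over a block starting at `K m` the path length is eventually at most `(e + 1) / K`, which this
  -- choice makes at most `v / 8`.
  obtain ⟨K, hKgt⟩ := exists_nat_gt (8 * (e + 1) / v)
  have hK : 0 < K := by
    have : (0 : ℝ) < K := lt_of_le_of_lt (by positivity) hKgt
    exact_mod_cast this
  have hK' : (0 : ℝ) < K := by exact_mod_cast hK
  have hKtop : Tendsto (fun m : ℕ => K * m) atTop atTop := tendsto_id.const_mul_atTop' hK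
  have hmove : ∀ᶠ m : ℕ in atTop, ∀ k ∈ Finset.Ico (K * m) ((K + 1) * m),
      ‖ϑ k - ϑ (K * m)‖ ≤ v / 8 := by
    obtain ⟨N, hN⟩ := eventually_atTop.1 hstep
    filter_upwards [(tendsto_sum_block_div havg hK).eventually_lt_const (lt_add_one e),
      hKtop.eventually_ge_atTop N, eventually_gt_atTop 0] with m hm hmN hm0 k hk
    have hm' : (0 : ℝ) < m := by exact_mod_cast hm0
    refine (dist_le_sum_block (s := fun i => ‖X i‖ / (i + 1)) (fun i => by positivity)
      (fun i hi => hN i (hmN.trans hi)) hk).trans ?_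
    calc ∑ i ∈ Finset.Ico (K * m) ((K + 1) * m), ‖X i‖ / ((i : ℝ) + 1)
        ≤ ∑ i ∈ Finset.Ico (K * m) ((K + 1) * m), ‖X i‖ / (K * m) := by
          refine Finset.sum_le_sum fun i hi => ?_
          refine div_le_div_of_nonneg_left (norm_nonneg _) (by positivity) ?_
          have : ((K * m : ℕ) : ℝ) ≤ i := by exact_mod_cast (Finset.mem_Ico.1 hi).1
          push_cast at this
          linarith
      _ = (∑ i ∈ Finset.Ico (K * m) ((K + 1) * m), ‖X i‖) / m / K := by
          rw [← Finset.sum_div]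
          field_simp
      _ ≤ (e + 1) / K := div_le_div_of_nonneg_right hm.le hK'.le
      _ ≤ v / 8 := by
          rw [div_lt_iff₀ hv0] at hKgt
          rw [div_le_div_iff₀ hK' (by norm_num)]
          linarith
  have hbdd : Bornology.IsBounded (Set.range fun m : ℕ => a - ϑ (K * m)) := by
    obtain ⟨B, hB⟩ := hv.bddAbove_range
    refine isBounded_iff_forall_norm_le.2 ⟨B, ?_⟩
    rintro _ ⟨m, rfl⟩
    rw [norm_sub_rev]
    exact hB ⟨K * m, rfl⟩
  obtain ⟨a', -, φ, hφ, hlim⟩ := tendsto_subseq_of_bounded hbdd fun m => ⟨m, rfl⟩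
  have hnorm : ‖a'‖ = v := by
    refine tendsto_nhds_unique hlim.norm ?_
    refine ((hv.comp hKtop).comp hφ.tendsto_atTop).congr fun j => ?_
    simp only [Function.comp_apply]
    rw [norm_sub_rev]
  -- The margin `v / 16` leaves room: errors in the block lie within `v / 8 + v / 8` of `b`, less
  -- than `‖b‖ / 2`.
  obtain ⟨b, hbA, hb⟩ := hA.exists_dist_lt a' (show 0 < v / 16 by positivity)
  rw [dist_eq_norm] at hb
  have hbnorm : 15 / 16 * v < ‖b‖ := by
    have := norm_sub_norm_le a' b
    rw [hnorm] at this
    linarith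
  obtain ⟨η, hη, π, hπ, hfr⟩ := hfreq b hbA (norm_pos_iff.1 (by linarith))
  set D : Set E := {u | ‖b‖ / 2 * ‖u‖ + η < inner ℝ b u} with hD
  have hclose : ∀ᶠ j in atTop, ‖a - ϑ (K * φ j) - b‖ < v / 8 := by
    have h1 : Tendsto (fun j => ‖a - ϑ (K * φ j) - b‖) atTop (𝓝 ‖a' - b‖) :=
      (hlim.sub_const b).norm
    exact h1.eventually_lt_const (by linarith)
  have hcount := (tendsto_sum_block_div hfr hK).eventually_const_lt (half_lt_self hπ)
  have hκ : 0 < η * h η := mul_pos hη (hpos η hη)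
  have hlow : ∀ᶠ j in atTop, η * h η / (K + 1) * (π / 2) ≤
      ∑ i ∈ Finset.Ico (K * φ j) ((K + 1) * φ j), 1 / ((i : ℝ) + 1) *
        (inner ℝ (a - ϑ i) (X i) * h (inner ℝ (a - ϑ i) (X i))) := by
    filter_upwards [hclose, hφ.tendsto_atTop.eventually hcount, hφ.tendsto_atTop.eventually hmove,
      hφ.tendsto_atTop.eventually (eventually_gt_atTop 0)] with j hj1 hj2 hj3 hj4
    set m := φ j
    have hm' : (0 : ℝ) < m := by exact_mod_cast hj4
    have hterm : ∀ i ∈ Finset.Ico (K * m) ((K + 1) * m),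
        η * h η / ((K + 1) * m) * D.indicator (fun _ => (1 : ℝ)) (X i)
          ≤ 1 / ((i : ℝ) + 1) * (inner ℝ (a - ϑ i) (X i) * h (inner ℝ (a - ϑ i) (X i))) := by
      intro i hi
      by_cases hX : X i ∈ D
      · rw [Set.indicator_of_mem hX, mul_one]
        have h1 : ‖a - ϑ i - b‖ ≤ ‖b‖ / 2 := by
          have h2 : a - ϑ i - b = (a - ϑ (K * m) - b) - (ϑ i - ϑ (K * m)) := by abel
          rw [h2]
          refine (norm_sub_le _ _).trans ?_
          linarith [hj3 i hi]
        -- Membership in `D` is designed for this: replacing `b` by a vector within `‖b‖ / 2` of it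
        -- still leaves inner product at least `η`.
        have h3 : η ≤ inner ℝ (a - ϑ i) (X i) := by
          have h4 : inner ℝ (a - ϑ i) (X i) = inner ℝ (a - ϑ i - b) (X i) + inner ℝ b (X i) := by
            rw [← inner_add_left, sub_add_cancel]
          have h5 := (abs_le.1 (abs_real_inner_le_norm (a - ϑ i - b) (X i))).1
          have h6 : ‖a - ϑ i - b‖ * ‖X i‖ ≤ ‖b‖ / 2 * ‖X i‖ :=
            mul_le_mul_of_nonneg_right h1 (norm_nonneg _)
          have h7 : ‖b‖ / 2 * ‖X i‖ + η < inner ℝ b (X i) := hX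
          linarith
        have h8 : η * h η ≤ inner ℝ (a - ϑ i) (X i) * h (inner ℝ (a - ϑ i) (X i)) :=
          mul_le_mul h3 (hmono h3) (hpos η hη).le (hη.le.trans h3)
        rw [div_eq_mul_one_div, mul_comm]
        refine mul_le_mul ?_ h8 hκ.le (by positivity)
        refine one_div_le_one_div_of_le (by positivity) ?_
        have := Nat.succ_le_of_lt (Finset.mem_Ico.1 hi).2
        exact_mod_cast this
      · rw [Set.indicator_of_notMem hX, mul_zero]
        exact mul_nonneg (by positivity) (hth _)
    refine le_trans ?_ (Finset.sum_le_sum hterm)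
    rw [← Finset.mul_sum]
    have h9 : η * h η / ((K + 1) * m) *
        ∑ i ∈ Finset.Ico (K * m) ((K + 1) * m), D.indicator (fun _ => (1 : ℝ)) (X i)
        = η * h η / (K + 1) *
          ((∑ i ∈ Finset.Ico (K * m) ((K + 1) * m), D.indicator (fun _ => (1 : ℝ)) (X i)) / m) := by
      field_simp
    rw [h9]
    exact mul_le_mul_of_nonneg_left hj2.le (by positivity)
  have h0 := ge_of_tendsto ((tendsto_sum_block_zero hsum hK).comp hφ.tendsto_atTop) hlow
  have : 0 < η * h η / (K + 1) * (π / 2) := by positivity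
  linarith

end Deterministic

/-! ### Convergence along a single good path. -/

section Pathwise

lemma tendsto_sum_Icc_indicator_atTop {p : ℕ → Prop} [DecidablePred p]
    (h : ∃ᶠ n in atTop, p (n + 1)) :
    Tendsto (fun n => ∑ i ∈ Finset.Icc 1 (n + 1), if p i then 1 else 0) atTop atTop := by
  have hmono : Monotone fun n => ∑ i ∈ Finset.Icc 1 (n + 1), if p i then 1 else 0 :=
    fun m n hmn => Finset.sum_le_sum_of_subset (Finset.Icc_subset_Icc_right (by omega))
  refine tendsto_atTop_atTop_of_monotone hmono fun b => ?_
  induction b with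
  | zero => exact ⟨0, Nat.zero_le _⟩
  | succ b ih =>
    obtain ⟨n, hn⟩ := ih
    obtain ⟨k, hk, hpk⟩ := frequently_atTop.1 h (n + 1)
    refine ⟨k, ?_⟩
    rw [Finset.sum_Icc_succ_top (by omega), if_pos hpk]
    obtain ⟨j, rfl⟩ : ∃ j, k = j + 1 := ⟨k - 1, by omega⟩
    have := hmono (show n ≤ j by omega)
    simp only at this
    omega

variable {d : ℕ} {M : ℕ → ℝ} {s : ℕ} {θ₁ a : EuclideanSpace ℝ (Fin d)}
  {x θ : ℕ → EuclideanSpace ℝ (Fin d)} {y w : ℕ → ℝ} {σ : ℕ → ℕ}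

lemma sub_inner_eq_noise_add (hy : ∀ k, y (k + 1) = inner ℝ a (x k) + w (k + 1)) (k : ℕ) :
    y (k + 1) - inner ℝ (θ k) (x k) = w (k + 1) + inner ℝ (a - θ k) (x k) := by
  rw [hy, inner_sub_left]
  ring

/-- One step of the untruncated recursion: the squared distance to the target changes by a drift
term, a centred noise term and a term of second order. -/
lemma norm_ladCandidate_sub_sq (hy : ∀ k, y (k + 1) = inner ℝ a (x k) + w (k + 1)) (h : ℝ → ℝ)
    (n : ℕ) :
    ‖ladCandidate x y θ (n + 1) - a‖ ^ 2 = ‖θ (n + 1) - a‖ ^ 2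
      - 2 * (1 / ((n : ℝ) + 1) * (inner ℝ (a - θ (n + 1)) (x (n + 1)) *
          h (inner ℝ (a - θ (n + 1)) (x (n + 1)))))
      + (‖x (n + 1)‖ ^ 2 / ((n : ℝ) + 1) ^ 2
        - 2 * (1 / ((n : ℝ) + 1) * inner ℝ (a - θ (n + 1)) (x (n + 1)) *
          (sgn (w (n + 2) + inner ℝ (a - θ (n + 1)) (x (n + 1)))
            - h (inner ℝ (a - θ (n + 1)) (x (n + 1)))))) := by
  unfold ladCandidate
  rw [sub_inner_eq_noise_add hy, add_sub_right_comm, norm_add_sq_real, inner_smul_right,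
    norm_smul, mul_pow, Real.norm_eq_abs, sq_abs, mul_pow, sgn_sq, ← neg_sub a (θ (n + 1)),
    inner_neg_left]
  push_cast
  have hn : (n : ℝ) + 1 ≠ 0 := by positivity
  field_simp
  ring

/-- Convergence of the truncated sign recursion along a path on which the noise series converge and
the regressors obey the law of large numbers. -/
lemma IsLADRecursion.tendsto (hrec : IsLADRecursion M s θ₁ x y θ σ) (hM : Tendsto M atTop atTop)
    (hy : ∀ k, y (k + 1) = inner ℝ a (x k) + w (k + 1)) {h : ℝ → ℝ} {e : ℝ}
    (hmono : Monotone h) (hpos : ∀ t, 0 < t → 0 < h t) (hth : ∀ t, 0 ≤ t * h t)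
    (hnoise : ∀ C : ℕ, ∃ l, Tendsto (fun n => ∑ i ∈ Finset.range n,
      (if ‖θ (i + 1) - a‖ ≤ C then 1 / ((i : ℝ) + 1) * inner ℝ (a - θ (i + 1)) (x (i + 1)) else 0) *
        (sgn (w (i + 2) + inner ℝ (a - θ (i + 1)) (x (i + 1)))
          - h (inner ℝ (a - θ (i + 1)) (x (i + 1))))) atTop (𝓝 l))
    (hsq : Summable fun n : ℕ => ‖x (n + 1)‖ ^ 2 / ((n : ℝ) + 1) ^ 2)
    (havg : Tendsto (fun n : ℕ => (∑ i ∈ Finset.range n, ‖x i‖) / n) atTop (𝓝 e))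
    {A : Set (EuclideanSpace ℝ (Fin d))} (hA : Dense A)
    (hfreq : ∀ b ∈ A, b ≠ 0 → ∃ η > 0, ∃ π > 0, Tendsto (fun n : ℕ => (∑ i ∈ Finset.range n,
      {u | ‖b‖ / 2 * ‖u‖ + η < inner ℝ b u}.indicator (fun _ => (1 : ℝ)) (x i)) / n)
      atTop (𝓝 π)) :
    Tendsto θ atTop (𝓝 a) := by
  set c : ℕ → EuclideanSpace ℝ (Fin d) := fun n => ladCandidate x y θ (n + 1) with hc
  let N : ℕ → ℕ → ℝ := fun C i =>
    (if ‖θ (i + 1) - a‖ ≤ C then 1 / ((i : ℝ) + 1) * inner ℝ (a - θ (i + 1)) (x (i + 1)) else 0) *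
      (sgn (w (i + 2) + inner ℝ (a - θ (i + 1)) (x (i + 1)))
        - h (inner ℝ (a - θ (i + 1)) (x (i + 1))))
  let p : ℕ → ℝ := fun n => 1 / ((n : ℝ) + 1) * (inner ℝ (a - θ (n + 1)) (x (n + 1)) *
    h (inner ℝ (a - θ (n + 1)) (x (n + 1))))
  -- The noise carries the cutoff at radius `C`, so its series converges unconditionally; it agrees
  -- with the true noise while the estimate is within `C` of `a`.
  let b : ℕ → ℕ → ℝ := fun C n => ‖x (n + 1)‖ ^ 2 / ((n : ℝ) + 1) ^ 2 - 2 * N C n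
  have hp0 : ∀ n, 0 ≤ p n := fun n => mul_nonneg (by positivity) (hth _)
  have hb : ∀ C, ∃ l, Tendsto (fun n => ∑ i ∈ Finset.range n, b C i) atTop (𝓝 l) := by
    intro C
    obtain ⟨l, hl⟩ := hnoise C
    refine ⟨_, (hsq.hasSum.tendsto_sum_nat.sub (hl.const_mul 2)).congr fun n => ?_⟩
    rw [Finset.mul_sum, ← Finset.sum_sub_distrib]
  have hexp : ∀ (C n : ℕ), ‖θ (n + 1) - a‖ ≤ C →
      ‖c n - a‖ ^ 2 = ‖θ (n + 1) - a‖ ^ 2 - 2 * p n + b C n := by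
    intro C n hn
    simp only [hc, b, N, p, if_pos hn]
    exact norm_ladCandidate_sub_sq hy h n
  have hkeep : ∀ n, ‖c n‖ ≤ M (σ (n + 1)) → θ (n + 1 + 1) = c n := fun n hn => by
    rw [hrec.theta_succ (n + 1) (by omega), if_pos hn]
  have hreset : ∀ n, M (σ (n + 1)) < ‖c n‖ → θ (n + 1 + 1) = 0 := fun n hn => by
    rw [hrec.theta_succ (n + 1) (by omega), if_neg (not_le.2 hn)]
  have hnotrunc : ∀ᶠ n in atTop, ‖c n‖ ≤ M (σ (n + 1)) := by
    obtain ⟨C, hC⟩ := exists_nat_ge (‖a‖ + 1)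
    refine eventually_not_truncated (ϑ := fun n => θ (n + 1)) hC (fun n hn => ?_) (hb C) hkeep
      hreset fun hfr => ?_
    · rw [hexp C n hn]
      linarith [hp0 n]
    -- Infinitely many truncations drive the index `σ`, and with it the bound, to infinity.
    · refine hM.comp ((tendsto_add_atTop_iff_nat 1).1 ?_)
      have h1 := tendsto_sum_Icc_indicator_atTop
        (p := fun i => M (σ i) < ‖ladCandidate x y θ i‖) hfr
      refine tendsto_atTop_mono (fun n => ?_) h1
      rw [hrec.sigma_succ (n + 1) (by omega)]
      exact Nat.le_add_left _ _
  obtain ⟨N₀, hN₀⟩ := eventually_atTop.1 hnotrunc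
  -- The index freezes once truncation stops. The comparison starts at `N₀ + 2` because `σ 1` is
  -- prescribed separately and need not fit the counting formula.
  have hσ : ∀ n, N₀ ≤ n → σ (n + 1 + 1) = σ (N₀ + 1 + 1) := by
    intro n hn
    induction n, hn using Nat.le_induction with
    | base => rfl
    | succ n hn ih =>
      rw [← ih, hrec.sigma_succ (n + 1 + 1) (by omega), hrec.sigma_succ (n + 1) (by omega),
        Finset.sum_Icc_succ_top (by omega), if_neg (not_lt.2 (hN₀ (n + 1) (by omega))), add_zero]
  have hbdd : ∀ᶠ n in atTop, ‖θ (n + 1)‖ ≤ M (σ (N₀ + 1 + 1)) := by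
    refine eventually_atTop.2 ⟨N₀ + 2, fun n hn => ?_⟩
    obtain ⟨j, rfl⟩ : ∃ j, n = j + 1 + 1 := ⟨n - 2, by omega⟩
    have h1 := hN₀ (j + 1) (by omega)
    rw [hσ j (by omega)] at h1
    rwa [hkeep (j + 1) (hN₀ (j + 1) (by omega))]
  obtain ⟨C, hC⟩ := exists_nat_ge (M (σ (N₀ + 1 + 1)) + ‖a‖)
  have hstep : ∀ᶠ n in atTop,
      ‖θ (n + 1 + 1) - a‖ ^ 2 = ‖θ (n + 1) - a‖ ^ 2 - 2 * p n + b C n := by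
    filter_upwards [hbdd, hnotrunc] with n h1 h2
    rw [hkeep n h2]
    exact hexp C n ((norm_sub_le _ _).trans (by linarith))
  obtain ⟨hps, v, hv⟩ := summable_and_tendsto_of_descent (V := fun n => ‖θ (n + 1) - a‖ ^ 2)
    (p := fun n => 2 * p n) (fun n => sq_nonneg _) (fun n => mul_nonneg zero_le_two (hp0 n)) hstep (hb C)
  have hps' : Summable p := (summable_mul_left_iff two_ne_zero).1 hps
  have hv' : Tendsto (fun n => ‖θ (n + 1) - a‖) atTop (𝓝 (Real.sqrt v)) := by
    simpa using hv.sqrt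
  rw [← tendsto_add_atTop_iff_nat 1]
  refine tendsto_of_summable_drift (ϑ := fun n => θ (n + 1)) (X := fun n => x (n + 1)) hmono hpos
    hth ?_ hv' hps'
    (tendsto_sum_range_succ_div (a := fun i => ‖x i‖) havg) hA ?_
  · filter_upwards [hnotrunc] with n hn
    rw [hkeep n hn]
    simp only [hc, ladCandidate, add_sub_cancel_left]
    rw [norm_smul, norm_mul, Real.norm_eq_abs, Real.norm_eq_abs, abs_sgn, mul_one,
      abs_of_nonneg (by positivity), mul_comm, ← div_eq_mul_one_div]
    push_cast
    exact le_rfl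
  · intro b hbA hb0
    obtain ⟨η, hη, π, hπ, hlim⟩ := hfreq b hbA hb0
    exact ⟨η, hη, π, hπ, tendsto_sum_range_succ_div (a := fun i =>
      {u | ‖b‖ / 2 * ‖u‖ + η < inner ℝ b u}.indicator (fun _ => (1 : ℝ)) (x i)) hlim⟩

end Pathwise

/-! ### Moments, averages and excitation of the regressors. -/

section Regressors

variable {Ω : Type*} [MeasurableSpace Ω] {P : Measure Ω} {d : ℕ}
  {x : ℕ → Ω → EuclideanSpace ℝ (Fin d)} {q : EuclideanSpace ℝ (Fin d) → ℝ} {l : ℝ}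

namespace RegressorAssumption

lemma map_eq (hx : RegressorAssumption P x q l) (k : ℕ) : P.map (x k) = P.map (x 0) := by
  rw [hx.hasDensity, hx.hasDensity]

lemma identDistrib (hx : RegressorAssumption P x q l) (k : ℕ) : IdentDistrib (x k) (x 0) P P :=
  ⟨(hx.measurable_x k).aemeasurable, (hx.measurable_x 0).aemeasurable, hx.map_eq k⟩

lemma integrable_norm_pow_four [IsProbabilityMeasure P] (hx : RegressorAssumption P x q l)
    (hl : 0 < l) (k : ℕ) : Integrable (fun ω => ‖x k ω‖ ^ 4) P := by
  obtain ⟨ε, hε, hI⟩ := hx.moment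
  refine ((integrable_const 1).add (hI k)).mono'
    ((hx.measurable_x k).norm.pow_const 4).aestronglyMeasurable (ae_of_all _ fun ω => ?_)
  have h0 := norm_nonneg (x k ω)
  rw [Real.norm_eq_abs, abs_of_nonneg (by positivity)]
  simp only [Pi.add_apply]
  rcases le_total ‖x k ω‖ 1 with h | h
  · have h1 : ‖x k ω‖ ^ 4 ≤ 1 := pow_le_one₀ h0 h
    linarith [Real.rpow_nonneg h0 (2 * (l + 2) + ε)]
  · have h1 : ‖x k ω‖ ^ (4 : ℝ) ≤ ‖x k ω‖ ^ (2 * (l + 2) + ε) :=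
      Real.rpow_le_rpow_of_exponent_le h (by linarith)
    have h2 : ‖x k ω‖ ^ (4 : ℝ) = ‖x k ω‖ ^ 4 := by
      rw [← Real.rpow_natCast]; norm_num
    rw [h2] at h1
    exact h1.trans (le_add_of_nonneg_left zero_le_one)

lemma memLp_norm [IsProbabilityMeasure P] (hx : RegressorAssumption P x q l)
    (hl : 0 < l) (k : ℕ) : MemLp (fun ω => ‖x k ω‖) 2 P := by
  refine (memLp_two_iff_integrable_sq (hx.measurable_x k).norm.aestronglyMeasurable).2 ?_
  refine ((integrable_const 1).add (hx.integrable_norm_pow_four hl k)).mono'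
    ((hx.measurable_x k).norm.pow_const 2).aestronglyMeasurable (ae_of_all _ fun ω => ?_)
  rw [Real.norm_eq_abs, abs_of_nonneg (by positivity)]
  simp only [Pi.add_apply]
  nlinarith [sq_nonneg (‖x k ω‖ ^ 2 - 1), sq_nonneg (‖x k ω‖ ^ 2)]

lemma integral_norm_sq_eq (hx : RegressorAssumption P x q l) (k : ℕ) :
    ∫ ω, ‖x k ω‖ ^ 2 ∂P = ∫ ω, ‖x 0 ω‖ ^ 2 ∂P :=
  ((hx.identDistrib k).comp (measurable_norm.pow_const 2)).integral_eq

lemma ae_summable_norm_sq_div [IsProbabilityMeasure P] (hx : RegressorAssumption P x q l)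
    (hl : 0 < l) :
    ∀ᵐ ω ∂P, Summable fun n : ℕ => ‖x (n + 1) ω‖ ^ 2 / ((n : ℝ) + 1) ^ 2 := by
  refine ae_summable_of_summable_integral
    (fun n => (hx.memLp_norm hl (n + 1)).integrable_sq.div_const _) (fun n ω => by positivity) ?_
  simp_rw [integral_div, hx.integral_norm_sq_eq, div_eq_mul_one_div (∫ ω, ‖x 0 ω‖ ^ 2 ∂P)]
  have := (summable_nat_add_iff 1).2 (Real.summable_one_div_nat_pow.2 one_lt_two)
  refine Summable.mul_left _ ?_
  simpa using this

lemma ae_tendsto_average_norm [IsProbabilityMeasure P] (hx : RegressorAssumption P x q l)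
    (hl : 0 < l) :
    ∀ᵐ ω ∂P, Tendsto (fun n : ℕ => (∑ i ∈ Finset.range n, ‖x i ω‖) / n) atTop
      (𝓝 (∫ ω, ‖x 0 ω‖ ∂P)) :=
  strong_law_of_mixing hx.measurable_x hx.map_eq hx.mixing measurable_norm
    (fun u => norm_nonneg u) (hx.integrable_norm_pow_four hl 0)

/-- The set is open and contains a small positive multiple of `b` inside the ball where `q > 0`, so
it meets that ball in positive volume. -/
lemma exists_pos_measure_cone (hx : RegressorAssumption P x q l)
    {b : EuclideanSpace ℝ (Fin d)} (hb : b ≠ 0) :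
    ∃ η > 0, 0 < P (x 0 ⁻¹' {u | ‖b‖ / 2 * ‖u‖ + η < inner ℝ b u}) := by
  obtain ⟨r, hr, hq⟩ := hx.q_pos
  have hb0 : 0 < ‖b‖ := norm_pos_iff.2 hb
  -- This puts `τ • b` at norm `r / 2`. There the two sides without margin differ by `τ‖b‖² / 2`,
  -- and `η` is half of that.
  set τ := r / (2 * ‖b‖) with hτ
  have hτ0 : 0 < τ := by positivity
  refine ⟨τ * ‖b‖ ^ 2 / 4, by positivity, ?_⟩
  set D := {u : EuclideanSpace ℝ (Fin d) | ‖b‖ / 2 * ‖u‖ + τ * ‖b‖ ^ 2 / 4 < inner ℝ b u} with hD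
  have hDo : IsOpen D := isOpen_lt (by fun_prop) (by fun_prop)
  have hmem : τ • b ∈ D ∩ Metric.ball 0 r := by
    have hn : ‖τ • b‖ = τ * ‖b‖ := by rw [norm_smul, Real.norm_eq_abs, abs_of_pos hτ0]
    constructor
    · change ‖b‖ / 2 * ‖τ • b‖ + τ * ‖b‖ ^ 2 / 4 < inner ℝ b (τ • b)
      rw [hn, inner_smul_right, real_inner_self_eq_norm_sq]
      have : 0 < τ * ‖b‖ ^ 2 := by positivity
      nlinarith
    · rw [mem_ball_zero_iff, hn, hτ]
      have : r / (2 * ‖b‖) * ‖b‖ = r / 2 := by field_simp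
      linarith
  have hvol : 0 < volume (D ∩ Metric.ball 0 r) :=
    (hDo.inter Metric.isOpen_ball).measure_pos volume ⟨_, hmem⟩
  rw [← Measure.map_apply (hx.measurable_x 0) hDo.measurableSet, hx.hasDensity, pos_iff_ne_zero,
    Ne, withDensity_apply_eq_zero hx.measurable_q.ennreal_ofReal]
  have hsub : D ∩ Metric.ball 0 r ⊆ {u | ENNReal.ofReal (q u) ≠ 0} ∩ D := fun u hu =>
    ⟨(ENNReal.ofReal_pos.2 (hq u hu.2)).ne', hu.1⟩
  exact fun h0 => hvol.ne' (measure_mono_null hsub h0)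

/-- The strong law for the indicator of each cone has its own null set, whence the countability of
`A`. -/
lemma ae_exists_frequency [IsProbabilityMeasure P] (hx : RegressorAssumption P x q l)
    {A : Set (EuclideanSpace ℝ (Fin d))} (hA : A.Countable) :
    ∀ᵐ ω ∂P, ∀ b ∈ A, b ≠ 0 → ∃ η > 0, ∃ π > 0,
      Tendsto (fun n : ℕ => (∑ i ∈ Finset.range n,
        {u | ‖b‖ / 2 * ‖u‖ + η < inner ℝ b u}.indicator (fun _ => (1 : ℝ)) (x i ω)) / n)
        atTop (𝓝 π) := by
  refine (ae_ball_iff hA).2 fun b _ => ?_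
  rcases eq_or_ne b 0 with rfl | hb
  · exact ae_of_all _ fun ω h => absurd rfl h
  obtain ⟨η, hη, hpos⟩ := hx.exists_pos_measure_cone hb
  set D := {u : EuclideanSpace ℝ (Fin d) | ‖b‖ / 2 * ‖u‖ + η < inner ℝ b u} with hD
  have hDm : MeasurableSet D :=
    (isOpen_lt (by fun_prop) (by fun_prop) : IsOpen D).measurableSet
  have hg : Measurable (D.indicator fun _ => (1 : ℝ)) := measurable_const.indicator hDm
  have hg0 : ∀ u, 0 ≤ D.indicator (fun _ => (1 : ℝ)) u :=
    fun u => Set.indicator_nonneg (fun _ _ => zero_le_one) u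
  have hg1 : ∀ u, D.indicator (fun _ => (1 : ℝ)) u ≤ 1 :=
    fun u => Set.indicator_le_self' (fun _ _ => zero_le_one) u
  have hlim := strong_law_of_mixing hx.measurable_x hx.map_eq hx.mixing hg hg0
    (Integrable.of_bound (C := 1)
      ((hg.comp (hx.measurable_x 0)).pow_const 4).aestronglyMeasurable (ae_of_all _ fun ω => by
        rw [Real.norm_eq_abs, abs_of_nonneg (pow_nonneg (hg0 _) 4)]
        exact pow_le_one₀ (hg0 _) (hg1 _)))
  have hI : ∫ ω, D.indicator (fun _ => (1 : ℝ)) (x 0 ω) ∂P = P.real (x 0 ⁻¹' D) := by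
    have h1 : (fun ω => D.indicator (fun _ => (1 : ℝ)) (x 0 ω)) = (x 0 ⁻¹' D).indicator 1 := rfl
    rw [h1, integral_indicator_one (hx.measurable_x 0 hDm)]
  filter_upwards [hlim] with ω hω _
  refine ⟨η, hη, _, ?_, hω⟩
  rw [hI]
  exact ENNReal.toReal_pos hpos.ne' (measure_ne_top _ _)

end RegressorAssumption

end Regressors

/-! ### Adaptedness of the estimates and convergence of the noise series. -/

section Adapted

variable {Ω : Type*} {d : ℕ}

/-- The information `x 0, …, x (n + 1), w 1, …, w (n + 1)`. -/
def pastFiltration {mΩ : MeasurableSpace Ω} {x : ℕ → Ω → EuclideanSpace ℝ (Fin d)} {w : ℕ → Ω → ℝ}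
    (hx : ∀ k, Measurable (x k)) (hw : ∀ k, Measurable (w (k + 1))) : Filtration ℕ mΩ where
  seq n := sigmaUpTo x (n + 1) ⊔
    ⨆ (i : ℕ) (_ : i < n + 1), MeasurableSpace.comap (w (i + 1)) inferInstance
  mono' m n hmn := sup_le_sup
    (biSup_mono fun i hi => hi.trans (by omega)) (biSup_mono fun i hi => hi.trans_le (by omega))
  le' n := sup_le (sigmaUpTo_le hx _) (iSup₂_le fun i _ => (hw i).comap_le)

lemma measurable_regressor_past {mΩ : MeasurableSpace Ω} {x : ℕ → Ω → EuclideanSpace ℝ (Fin d)}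
    {w : ℕ → Ω → ℝ} (hx : ∀ k, Measurable (x k)) (hw : ∀ k, Measurable (w (k + 1))) (n : ℕ) :
    Measurable[pastFiltration hx hw n] (x (n + 1)) :=
  (comap_measurable (x (n + 1))).mono
    ((comap_le_sigmaUpTo x le_rfl).trans le_sup_left) le_rfl

lemma measurable_noise_past {mΩ : MeasurableSpace Ω} {x : ℕ → Ω → EuclideanSpace ℝ (Fin d)}
    {w : ℕ → Ω → ℝ} (hx : ∀ k, Measurable (x k)) (hw : ∀ k, Measurable (w (k + 1))) (n : ℕ) :
    Measurable[pastFiltration hx hw n] (w (n + 1)) :=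
  (comap_measurable (w (n + 1))).mono
    ((le_iSup₂_of_le (f := fun (i : ℕ) (_ : i < n + 1) =>
      MeasurableSpace.comap (w (i + 1)) inferInstance) n n.lt_succ_self le_rfl).trans
      le_sup_right) le_rfl

lemma measurable_ladCandidate {_ : MeasurableSpace Ω} {x θ : ℕ → Ω → EuclideanSpace ℝ (Fin d)}
    {y : ℕ → Ω → ℝ} {k : ℕ} (hθ : Measurable (θ k)) (hx : Measurable (x k))
    (hy : Measurable (y (k + 1))) :
    Measurable fun ω => ladCandidate (fun j => x j ω) (fun j => y j ω) (fun j => θ j ω) k :=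
  hθ.add (((measurable_sgn.comp (hy.sub (hθ.inner hx))).const_mul _).smul hx)

lemma measurable_truncate {_ : MeasurableSpace Ω} {c : Ω → EuclideanSpace ℝ (Fin d)} {τ : Ω → ℕ}
    (M : ℕ → ℝ) (hc : Measurable c) (hτ : Measurable τ) :
    Measurable fun ω => if ‖c ω‖ ≤ M (τ ω) then c ω else 0 :=
  Measurable.ite (measurableSet_le hc.norm (measurable_from_top.comp hτ)) hc measurable_const

lemma measurable_truncation_indicator {_ : MeasurableSpace Ω} {c : Ω → EuclideanSpace ℝ (Fin d)}
    {τ : Ω → ℕ} (M : ℕ → ℝ) (hc : Measurable c) (hτ : Measurable τ) :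
    Measurable fun ω => if M (τ ω) < ‖c ω‖ then 1 else 0 :=
  Measurable.ite (measurableSet_lt (measurable_from_top.comp hτ) hc.norm) measurable_const
    measurable_const

lemma measurable_cutoff {_ : MeasurableSpace Ω} {u : Ω → EuclideanSpace ℝ (Fin d)} {v : Ω → ℝ}
    (C : ℝ) (hu : Measurable u) (hv : Measurable v) :
    Measurable fun ω => if ‖u ω‖ ≤ C then v ω else 0 :=
  Measurable.ite (measurableSet_le hu.norm measurable_const) hv measurable_const

/-- Strong induction is needed because the truncation index counts all earlier truncations. -/
lemma adapted_of_isLADRecursion {mΩ : MeasurableSpace Ω} {a θ₁ : EuclideanSpace ℝ (Fin d)}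
    {x θ : ℕ → Ω → EuclideanSpace ℝ (Fin d)} {w y : ℕ → Ω → ℝ} {σ : ℕ → Ω → ℕ} {M : ℕ → ℝ} {s : ℕ}
    (hx : ∀ k, Measurable (x k)) (hw : ∀ k, Measurable (w (k + 1)))
    (hy : ∀ k ω, y (k + 1) ω = inner ℝ a (x k ω) + w (k + 1) ω)
    (hθ : ∀ ω, IsLADRecursion M s θ₁ (fun k => x k ω) (fun k => y k ω)
      (fun k => θ k ω) (fun k => σ k ω)) (n : ℕ) :
    Measurable[pastFiltration hx hw n] (θ (n + 1)) ∧
      Measurable[pastFiltration hx hw n] (σ (n + 1)) := by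
  set ℱ := pastFiltration hx hw
  induction n using Nat.strong_induction_on with
  | _ n ih =>
    cases n with
    | zero =>
      have h1 : θ (0 + 1) = fun _ => θ₁ := funext fun ω => (hθ ω).theta_one
      have h2 : σ (0 + 1) = fun _ => 1 := funext fun ω => (hθ ω).sigma_one
      rw [h1, h2]
      exact ⟨measurable_const, measurable_const⟩
    | succ n =>
      have hc : ∀ i, i ≤ n → Measurable[ℱ (n + 1)] fun ω =>
          ladCandidate (fun j => x j ω) (fun j => y j ω) (fun j => θ j ω) (i + 1) := by
        intro i hi
        have hxi : Measurable[ℱ (n + 1)] (x (i + 1)) :=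
          (measurable_regressor_past hx hw i).mono (ℱ.mono (by omega)) le_rfl
        have hwi : Measurable[ℱ (n + 1)] (w (i + 1 + 1)) :=
          (measurable_noise_past hx hw (i + 1)).mono (ℱ.mono (by omega)) le_rfl
        refine measurable_ladCandidate
          ((ih i (by omega)).1.mono (ℱ.mono (by omega)) le_rfl) hxi ?_
        rw [show y (i + 1 + 1) = fun ω => inner ℝ a (x (i + 1) ω) + w (i + 1 + 1) ω from
          funext fun ω => hy _ ω]
        exact (measurable_const.inner hxi).add hwi
      have hσ : ∀ i, i ≤ n → Measurable[ℱ (n + 1)] (σ (i + 1)) := fun i hi =>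
        (ih i (by omega)).2.mono (ℱ.mono (by omega)) le_rfl
      constructor
      · rw [show θ (n + 1 + 1) = _ from funext fun ω => (hθ ω).theta_succ (n + 1) (by omega)]
        exact measurable_truncate M (hc n le_rfl) (hσ n le_rfl)
      · rw [show σ (n + 1 + 1) = _ from funext fun ω => (hθ ω).sigma_succ (n + 1) (by omega)]
        refine measurable_const.add (Finset.measurable_fun_sum _ fun i hi => ?_)
        obtain ⟨j, rfl⟩ : ∃ j, i = j + 1 := ⟨i - 1, by have := (Finset.mem_Icc.1 hi).1; omega⟩
        have hj : j ≤ n := by have := (Finset.mem_Icc.1 hi).2; omega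
        exact measurable_truncation_indicator M (hc j hj) (hσ j hj)

/-- The centred noise terms of the recursion, switched off outside a ball, form an almost surely
convergent series. -/
lemma ae_exists_tendsto_noise_sum [mΩ : MeasurableSpace Ω] {P : Measure Ω} [IsProbabilityMeasure P]
    {a θ₁ : EuclideanSpace ℝ (Fin d)} {x θ : ℕ → Ω → EuclideanSpace ℝ (Fin d)} {w y : ℕ → Ω → ℝ}
    {q : EuclideanSpace ℝ (Fin d) → ℝ} {f : ℝ → ℝ} {l : ℝ} (hl : 0 < l)
    (hx : RegressorAssumption P x q l) (hw : NoiseAssumption P x w f l)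
    {σ : ℕ → Ω → ℕ} {M : ℕ → ℝ} {s : ℕ}
    (hy : ∀ k ω, y (k + 1) ω = inner ℝ a (x k ω) + w (k + 1) ω)
    (hθ : ∀ ω, IsLADRecursion M s θ₁ (fun k => x k ω) (fun k => y k ω)
      (fun k => θ k ω) (fun k => σ k ω)) (C : ℕ) :
    ∀ᵐ ω ∂P, ∃ c, Tendsto (fun n => ∑ i ∈ Finset.range n,
      (if ‖θ (i + 1) ω - a‖ ≤ C then
        1 / ((i : ℝ) + 1) * inner ℝ (a - θ (i + 1) ω) (x (i + 1) ω) else 0) *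
        (sgn (w (i + 2) ω + inner ℝ (a - θ (i + 1) ω) (x (i + 1) ω))
          - signDrift (P.map (w 1)) (inner ℝ (a - θ (i + 1) ω) (x (i + 1) ω)))) atTop (𝓝 c) := by
  set ℱ := pastFiltration hx.measurable_x hw.measurable_w
  have hprob : IsProbabilityMeasure (P.map (w 1)) :=
    Measure.isProbabilityMeasure_map (hw.measurable_w 0).aemeasurable
  have hlaw : ∀ k, P.map (w (k + 1)) = P.map (w 1) := fun k => by
    rw [hw.hasDensity k, ← hw.hasDensity 0]
  let t : ℕ → Ω → ℝ := fun i ω => inner ℝ (a - θ (i + 1) ω) (x (i + 1) ω)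
  let α : ℕ → Ω → ℝ := fun i ω => if ‖θ (i + 1) ω - a‖ ≤ C then 1 / ((i : ℝ) + 1) * t i ω else 0
  have hθm : ∀ n, Measurable[ℱ n] (θ (n + 1)) := fun n =>
    (adapted_of_isLADRecursion hx.measurable_x hw.measurable_w hy hθ n).1
  have hxm : ∀ n, Measurable[ℱ n] (x (n + 1)) :=
    measurable_regressor_past hx.measurable_x hw.measurable_w
  have htm : ∀ n, Measurable[ℱ n] (t n) := fun n =>
    Measurable.inner (measurable_const.sub (hθm n)) (hxm n)
  have hαm : ∀ n, Measurable[ℱ n] (α n) := fun n =>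
    measurable_cutoff C ((hθm n).sub_const a) ((htm n).const_mul _)
  -- The cutoff removes the uncontrolled size of the estimate; the second moment of the regressor
  -- then suffices for square integrability.
  have hαb : ∀ n ω, |α n ω| ≤ C / ((n : ℝ) + 1) * ‖x (n + 1) ω‖ := by
    intro n ω
    simp only [α]
    split_ifs with h
    · rw [abs_mul, abs_of_nonneg (by positivity : (0 : ℝ) ≤ 1 / ((n : ℝ) + 1))]
      have h1 : |t n ω| ≤ C * ‖x (n + 1) ω‖ := by
        refine (abs_real_inner_le_norm _ _).trans ?_
        rw [norm_sub_rev]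
        exact mul_le_mul_of_nonneg_right h (norm_nonneg _)
      calc 1 / ((n : ℝ) + 1) * |t n ω| ≤ 1 / ((n : ℝ) + 1) * (C * ‖x (n + 1) ω‖) :=
            mul_le_mul_of_nonneg_left h1 (by positivity)
        _ = C / ((n : ℝ) + 1) * ‖x (n + 1) ω‖ := by ring
    · rw [abs_zero]
      positivity
  let D : ℕ → Ω → ℝ := fun i ω =>
    α i ω * (sgn (w (i + 2) ω + t i ω) - signDrift (P.map (w 1)) (t i ω))
  have hDm : ∀ n, Measurable[ℱ (n + 1)] (D n) := by
    intro n
    have hmono : ℱ n ≤ ℱ (n + 1) := ℱ.mono n.le_succ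
    have h1 : Measurable[ℱ (n + 1)] (t n) := (htm n).mono hmono le_rfl
    have h2 : Measurable[ℱ (n + 1)] (w (n + 2)) :=
      measurable_noise_past hx.measurable_x hw.measurable_w (n + 1)
    exact ((hαm n).mono hmono le_rfl).mul ((measurable_sgn.comp (h2.add h1)).sub
      ((monotone_signDrift _).measurable.comp h1))
  have hαL : ∀ n, MemLp (α n) 2 P := fun n =>
    ((hx.memLp_norm hl (n + 1)).const_mul (C / ((n : ℝ) + 1))).mono
      ((hαm n).mono (ℱ.le n) le_rfl).aestronglyMeasurable (ae_of_all _ fun ω => by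
        rw [Real.norm_eq_abs, Real.norm_eq_abs]
        exact (hαb n ω).trans (le_abs_self _))
  have hDb : ∀ n ω, |D n ω| ≤ 2 * |α n ω| := by
    intro n ω
    simp only [D]
    rw [abs_mul, mul_comm]
    refine mul_le_mul_of_nonneg_right ((abs_sub _ _).trans ?_) (abs_nonneg _)
    rw [abs_sgn]
    linarith [abs_signDrift_le (P.map (w 1)) (t n ω)]
  have hDL : ∀ n, MemLp (D n) 2 P := fun n =>
    ((hαL n).const_mul 2).mono ((hDm n).mono (ℱ.le _) le_rfl).aestronglyMeasurable
      (ae_of_all _ fun ω => by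
        rw [Real.norm_eq_abs, Real.norm_eq_abs, abs_mul 2, abs_two]
        exact hDb n ω)
  refine ae_exists_tendsto_sum_of_orthogonal ℱ hDm hDL ?_ ?_
  · intro n g hg hgL
    -- The past from which `w (n + 2)` is independent is exactly `ℱ n`. The weight is the test
    -- function times `α n`, integrable as a product of two `L²` functions.
    have h := integral_mul_sgn_sub_signDrift (ℱ.le n) (hw.measurable_w (n + 1))
      (hw.indep_past (n + 1)) (hg.mul (hαm n)) (htm n) (hgL.integrable_mul (hαL n))
    rw [hlaw] at h
    refine (integral_congr_ae (ae_of_all _ fun ω => ?_)).trans h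
    exact (mul_assoc _ _ _).symm
  · have hsum : Summable fun n : ℕ =>
        4 * (C : ℝ) ^ 2 * (∫ ω, ‖x 0 ω‖ ^ 2 ∂P) * (1 / ((n + 1 : ℕ) : ℝ) ^ 2) :=
      ((summable_nat_add_iff 1).2 (Real.summable_one_div_nat_pow.2 one_lt_two)).mul_left _
    refine Summable.of_nonneg_of_le (fun n => integral_nonneg fun ω => sq_nonneg _)
      (fun n => ?_) hsum
    have h1 : ∫ ω, D n ω ^ 2 ∂P ≤ ∫ ω, (2 * (C / ((n : ℝ) + 1))) ^ 2 * ‖x (n + 1) ω‖ ^ 2 ∂P := by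
      refine integral_mono (hDL n).integrable_sq
        ((hx.memLp_norm hl (n + 1)).integrable_sq.const_mul _) fun ω => ?_
      simp only
      rw [← mul_pow, ← sq_abs (D n ω)]
      refine pow_le_pow_left₀ (abs_nonneg _) ?_ 2
      linarith [hDb n ω, hαb n ω]
    refine h1.trans (le_of_eq ?_)
    rw [integral_const_mul, hx.integral_norm_sq_eq]
    push_cast
    have hn : (n : ℝ) + 1 ≠ 0 := by positivity
    field_simp
    ring

end Adapted

/-! ### Almost sure convergence of the estimates. -/

theorem theorem4 {Ω : Type*} [MeasurableSpace Ω] (P : Measure Ω) [IsProbabilityMeasure P]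
    {d : ℕ} (θstar : EuclideanSpace ℝ (Fin d))
    (x : ℕ → Ω → EuclideanSpace ℝ (Fin d)) (w : ℕ → Ω → ℝ) (y : ℕ → Ω → ℝ)
    (hy : ∀ k ω, y (k + 1) ω = inner ℝ θstar (x k ω) + w (k + 1) ω)
    (l : ℝ) (hl : 0 < l)
    (q : EuclideanSpace ℝ (Fin d) → ℝ) (hx : RegressorAssumption P x q l)
    (f : ℝ → ℝ) (hw : NoiseAssumption P x w f l)
    (M : ℕ → ℝ) (hMpos : ∀ k, 0 < M k) (hM : Tendsto M atTop atTop)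
    (s : ℕ) (θ₁ : EuclideanSpace ℝ (Fin d))
    (θ : ℕ → Ω → EuclideanSpace ℝ (Fin d)) (σ : ℕ → Ω → ℕ)
    (hθ : ∀ ω, IsLADRecursion M s θ₁ (fun k => x k ω) (fun k => y k ω)
      (fun k => θ k ω) (fun k => σ k ω)) :
    ∀ᵐ ω ∂P, Tendsto (fun k => θ k ω) atTop (𝓝 θstar) := by
  have hprob : IsProbabilityMeasure (P.map (w 1)) :=
    Measure.isProbabilityMeasure_map (hw.measurable_w 0).aemeasurable
  have hmono := monotone_signDrift (P.map (w 1))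
  have hzero : signDrift (P.map (w 1)) 0 = 0 :=
    signDrift_zero_of_even hw.measurable_f (hw.hasDensity 0) hw.f_even
  have hpos : ∀ t, 0 < t → 0 < signDrift (P.map (w 1)) t := fun t ht =>
    signDrift_pos hw.measurable_f (hw.hasDensity 0) hw.f_even hw.f_pos hw.f_cont ht
  have hth : ∀ t, 0 ≤ t * signDrift (P.map (w 1)) t := by
    intro t
    rcases le_total 0 t with ht | ht
    · exact mul_nonneg ht (hzero ▸ hmono ht)
    · exact mul_nonneg_of_nonpos_of_nonpos ht (hzero ▸ hmono ht)
  obtain ⟨A, hAc, hAd⟩ := TopologicalSpace.exists_countable_dense (EuclideanSpace ℝ (Fin d))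
  filter_upwards [ae_all_iff.2 fun C : ℕ => ae_exists_tendsto_noise_sum hl hx hw hy hθ C,
    hx.ae_summable_norm_sq_div hl, hx.ae_tendsto_average_norm hl, hx.ae_exists_frequency hAc]
    with ω hnoise hsq havg hfreq
  exact (hθ ω).tendsto (w := fun k => w k ω) hM (fun k => hy k ω) hmono hpos hth hnoise hsq havg
    hAd hfreq
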